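/- **Setting.** A finite-dimensional quantum resource theory (QRT) consists of a collection of finite-dimensional quantum systems $\mathcal H$, containing $\mathbb C$ and closed under tensor products; for each system a compact set $\mathcal S(\mathcal H)$ of density operators on $\mathcal H$ (the states of interest); and for each pair of systems a compact set $\mathcal O(\mathcal H\to\mathcal H')$ of completely positive trace-preserving maps (the free operations) that map $\mathcal S(\mathcal H)$ into $\mathcal S(\mathcal H')$, such that the free operations are closed under composition and under tensor products, and the identity maps $\mathrm{id}\in\mathcal O(\mathcal H\to\mathcal H)$ and the traces $\mathrm{tr}\in\mathcal O(\mathcal H\to\mathbb C)$ are free. Here $(\mathcal H_1\otimes\mathcal H_2)\otimes\mathcal H_3$ is identified with $\mathcal H_1\otimes(\mathcal H_2\otimes\mathcal H_3)$, and $\mathbb C\otimes\mathcal H$ and $\mathcal H\otimes\mathbb C$ with $\mathcal H$; that is, these canonical identifications are free operations in both directions. The QRT is convex if every $\mathcal O(\mathcal H\to\mathcal H')$ is convex. The set of free states is $$\mathcal F(\mathcal H)=\{\psi\in\mathcal S(\mathcal H):\ \forall\mathcal H',\ \forall\phi\in\mathcal S(\mathcal H'),\ \exists\,\mathcal N\in\mathcal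 O(\mathcal H'\to\mathcal H)\text{ with }\psi=\mathcal N(\phi)\}.$$ For $\phi\in\mathcal S(\mathcal H_1)$ and $\psi\in\mathcal S(\mathcal H_2)$ the conversion rate $r_{\mathrm{conv}}(\phi\to\psi)\in[0,\infty]$ is the supremum of all real $r\ge 0$ for which there are $\mathcal N_n\in\mathcal O(\mathcal H_1^{\otimes n}\to\mathcal H_2^{\otimes\lceil rn\rceil})$, $n\in\mathbb N$, with $\liminf_{n\to\infty}\|\mathcal N_n(\phi^{\otimes n})-\psi^{\otimes\lceil rn\rceil}\|_1=0$ (where $\phi^{\otimes 0}=1$). A resource measure is a family of functions $R_{\mathcal H}:\mathcal S(\mathcal H)\to\mathbb R$ with $R_{\mathcal H'}(\mathcal N(\psi))\le R_{\mathcal H}(\psi)$ for all $\psi\in\mathcal S(\mathcal H)$ and all $\mathcal N\in\mathcal O(\mathcal H\to\mathcal H')$. It is consistent if $R_{\mathcal H}(\psi)\,r_{\mathrm{conv}}(\phi\to\psi)\le R_{\mathcal H'}(\phi)$ for all systems $\mathcal H,\mathcal H'$ and all $\psi\in\mathcal S(\mathcal H)$, $\phi\in\mathcal S(\mathcal H')$,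 with the convention $0\cdot\infty=0$. For an operator $\rho$ on $\mathcal H$ let $R_{\mathrm R}(\rho)=\inf_{\sigma\in\mathcal F(\mathcal H)}D(\rho\|\sigma)$, where $D(\rho\|\sigma)=\operatorname{tr}\rho\log_2\rho-\operatorname{tr}\rho\log_2\sigma$ if $\ker\sigma\subseteq\ker\rho$ and $D(\rho\|\sigma)=+\infty$ otherwise. **Theorem.** Consider a finite-dimensional convex QRT in which $\mathcal F(\mathcal H)$ contains a full-rank state for every system $\mathcal H$. Then for every system $\mathcal H$ and every $\psi\in\mathcal S(\mathcal H)$ the limit $$R_{\mathrm R}^\infty(\psi)=\lim_{n\to\infty}\frac{R_{\mathrm R}(\psi^{\otimes n})}{n}$$ exists and is a real number, and the regularized relative entropy of resource $R_{\mathrm R}^\infty$ is a consistent resource measure. -/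

import Mathlib

open Filter Topology
open scoped Kronecker ComplexOrder

universe u v

noncomputable section

namespace QuantumResource

/-! ### Finite-dimensional quantum mechanics on `ℂ^ι` -/

section Matrices

variable {ι κ ι₁ ι₂ κ₁ κ₂ : Type*}

/-- Density operators: positive semidefinite matrices of trace one. -/
def IsDensity [Fintype ι] (ρ : Matrix ι ι ℂ) : Prop :=
  ρ.PosSemidef ∧ ρ.trace = 1

/-- The tensor product `M ⊗ N` of two linear maps between matrix algebras, see
`tensorMap_kronecker`. -/
def tensorMap (M : Matrix ι₁ ι₁ ℂ →ₗ[ℂ] Matrix κ₁ κ₁ ℂ)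
    (N : Matrix ι₂ ι₂ ℂ →ₗ[ℂ] Matrix κ₂ κ₂ ℂ) :
    Matrix (ι₁ × ι₂) (ι₁ × ι₂) ℂ →ₗ[ℂ] Matrix (κ₁ × κ₂) (κ₁ × κ₂) ℂ where
  toFun Z := Matrix.of fun p q =>
    M (Matrix.of fun k l => N (Matrix.of fun i j => Z (k, i) (l, j)) p.2 q.2) p.1 q.1
  map_add' X Y := by
    ext p q
    have h : (Matrix.of fun k l => N (Matrix.of fun i j => (X + Y) (k, i) (l, j)) p.2 q.2) =
        (Matrix.of fun k l => N (Matrix.of fun i j => X (k, i) (l, j)) p.2 q.2) +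
          Matrix.of fun k l => N (Matrix.of fun i j => Y (k, i) (l, j)) p.2 q.2 := by
      ext k l
      exact congrFun (congrFun (N.map_add (Matrix.of fun i j => X (k, i) (l, j))
        (Matrix.of fun i j => Y (k, i) (l, j))) p.2) q.2
    exact congrFun (congrFun ((congrArg M h).trans (M.map_add _ _)) p.1) q.1
  map_smul' c X := by
    ext p q
    have h : (Matrix.of fun k l => N (Matrix.of fun i j => (c • X) (k, i) (l, j)) p.2 q.2) =
        c • (Matrix.of fun k l => N (Matrix.of fun i j => X (k, i) (l, j)) p.2 q.2) := by
      ext k l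
      exact congrFun (congrFun (N.map_smul c (Matrix.of fun i j => X (k, i) (l, j))) p.2) q.2
    exact congrFun (congrFun ((congrArg M h).trans (M.map_smul _ _)) p.1) q.1

theorem tensorMap_kronecker (M : Matrix ι₁ ι₁ ℂ →ₗ[ℂ] Matrix κ₁ κ₁ ℂ)
    (N : Matrix ι₂ ι₂ ℂ →ₗ[ℂ] Matrix κ₂ κ₂ ℂ) (X : Matrix ι₁ ι₁ ℂ) (Y : Matrix ι₂ ι₂ ℂ) :
    tensorMap M N (X ⊗ₖ Y) = M X ⊗ₖ N Y := by
  ext p q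
  have h1 : ∀ k l, (Matrix.of fun i j => (X ⊗ₖ Y) (k, i) (l, j)) = X k l • Y :=
    fun k l => rfl
  have h2 : (Matrix.of fun k l => (X k l • N Y) p.2 q.2) = (N Y p.2 q.2) • X := by
    ext k l
    simp [mul_comm]
  simp only [tensorMap, LinearMap.coe_mk, AddHom.coe_mk, Matrix.of_apply, h1, map_smul, h2]
  simp [Matrix.kroneckerMap_apply, mul_comm]

/-- Complete positivity: `M ⊗ id` preserves positive semidefiniteness for every
finite-dimensional ancilla. -/
def IsCompletelyPositive (M : Matrix ι ι ℂ →ₗ[ℂ] Matrix κ κ ℂ) : Prop :=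
  ∀ (d : ℕ) (X : Matrix (ι × Fin d) (ι × Fin d) ℂ), X.PosSemidef →
    (tensorMap M (LinearMap.id : Matrix (Fin d) (Fin d) ℂ →ₗ[ℂ] _) X).PosSemidef

/-- Completely positive and trace-preserving linear maps. -/
def IsCPTP [Fintype ι] [Fintype κ] (M : Matrix ι ι ℂ →ₗ[ℂ] Matrix κ κ ℂ) : Prop :=
  IsCompletelyPositive M ∧ ∀ X, (M X).trace = X.trace

/-- The linear map identifying operators on `ℂ^ι` with operators on `ℂ^κ` along a bijection of
the standard bases. -/
def relabel (e : ι ≃ κ) : Matrix ι ι ℂ →ₗ[ℂ] Matrix κ κ ℂ :=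
  (Matrix.reindexLinearEquiv ℂ ℂ e e).toLinearMap

/-- The trace norm `‖X‖₁ = tr √(X† X)`. -/
def traceNorm [Fintype ι] [DecidableEq ι] (X : Matrix ι ι ℂ) : ℝ :=
  (cfc Real.sqrt (X.conjTranspose * X)).trace.re

/-- The quantum relative entropy `D(ψ‖φ) = tr ψ log₂ ψ - tr ψ log₂ φ`, equal to `+∞` unless
the kernel of `φ` is contained in the kernel of `ψ`. As `Real.logb 2 0 = 0`, the
logarithms are taken on the supports, which is the convention `0 log 0 = 0`. -/
def relEntropy [Fintype ι] [DecidableEq ι] (ψ φ : Matrix ι ι ℂ) : EReal :=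
  open Classical in
  if ∀ w : ι → ℂ, φ.mulVec w = 0 → ψ.mulVec w = 0 then
    (((ψ * cfc (Real.logb 2) ψ).trace.re - (ψ * cfc (Real.logb 2) φ).trace.re : ℝ) : EReal)
  else ⊤

end Matrices

/-! ### Quantum systems -/

/-- A collection of finite-dimensional quantum systems closed under tensor products and
containing the trivial system `ℂ`. The Hilbert space of `A` is `ℂ^(idx A)`, and the Hilbert space
of `tensor A B` is identified with the tensor product of those of `A` and `B` by matching
the product basis. The label `A` may carry more data than the Hilbert space, such as
a bipartition. -/
structure Systems where
  Sys : Type u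
  idx : Sys → Type v
  [fintypeIdx : ∀ A, Fintype (idx A)]
  [decEqIdx : ∀ A, DecidableEq (idx A)]
  [nonemptyIdx : ∀ A, Nonempty (idx A)]
  tensor : Sys → Sys → Sys
  tensorIdx : ∀ A B, idx (tensor A B) ≃ idx A × idx B
  one : Sys
  [uniqueIdx : Unique (idx one)]

attribute [instance] Systems.fintypeIdx Systems.decEqIdx Systems.nonemptyIdx Systems.uniqueIdx

namespace Systems

variable (Q : Systems.{u, v})

/-- Operators on the Hilbert space of the system `A`. -/
abbrev Op (A : Q.Sys) : Type v := Matrix (Q.idx A) (Q.idx A) ℂ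

variable {Q}

/-- The operator `X ⊗ Y` on `A ⊗ B`. -/
def tensorOp {A B : Q.Sys} (X : Q.Op A) (Y : Q.Op B) : Q.Op (Q.tensor A B) :=
  relabel (Q.tensorIdx A B).symm (X ⊗ₖ Y)

/-- The map `M ⊗ N` from operators on `A₁ ⊗ A₂` to operators on `B₁ ⊗ B₂`. -/
def tensorHom {A₁ B₁ A₂ B₂ : Q.Sys} (M : Q.Op A₁ →ₗ[ℂ] Q.Op B₁) (N : Q.Op A₂ →ₗ[ℂ] Q.Op B₂) :
    Q.Op (Q.tensor A₁ A₂) →ₗ[ℂ] Q.Op (Q.tensor B₁ B₂) :=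
  relabel (Q.tensorIdx B₁ B₂).symm ∘ₗ tensorMap M N ∘ₗ relabel (Q.tensorIdx A₁ A₂)

/-- The trace, as a map to operators on the trivial system. -/
def traceHom (A : Q.Sys) : Q.Op A →ₗ[ℂ] Q.Op Q.one :=
  (Matrix.traceLinearMap (Q.idx A) ℂ ℂ).smulRight (1 : Q.Op Q.one)

/-- The canonical identification of `(A ⊗ B) ⊗ C` with `A ⊗ (B ⊗ C)`. -/
def assocIdx (A B C : Q.Sys) :
    Q.idx (Q.tensor (Q.tensor A B) C) ≃ Q.idx (Q.tensor A (Q.tensor B C)) :=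
  (Q.tensorIdx (Q.tensor A B) C).trans <|
    (Equiv.prodCongr (Q.tensorIdx A B) (Equiv.refl (Q.idx C))).trans <|
    (Equiv.prodAssoc (Q.idx A) (Q.idx B) (Q.idx C)).trans <|
    (Equiv.prodCongr (Equiv.refl (Q.idx A)) (Q.tensorIdx B C).symm).trans
    (Q.tensorIdx A (Q.tensor B C)).symm

/-- The canonical identification of `ℂ ⊗ A` with `A`. -/
def leftUnitIdx (A : Q.Sys) : Q.idx (Q.tensor Q.one A) ≃ Q.idx A :=
  (Q.tensorIdx Q.one A).trans (Equiv.uniqueProd (Q.idx A) (Q.idx Q.one))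

/-- The canonical identification of `A ⊗ ℂ` with `A`. -/
def rightUnitIdx (A : Q.Sys) : Q.idx (Q.tensor A Q.one) ≃ Q.idx A :=
  (Q.tensorIdx A Q.one).trans (Equiv.prodUnique (Q.idx A) (Q.idx Q.one))

/-- The system `A^{⊗ n}`, with `A^{⊗ 0} = ℂ`. -/
def pow (A : Q.Sys) : ℕ → Q.Sys
  | 0 => Q.one
  | n + 1 => Q.tensor (pow A n) A

/-- The operator `X^{⊗ n}` on `A^{⊗ n}`, with `X^{⊗ 0} = 1`. -/
def opPow {A : Q.Sys} (X : Q.Op A) : (n : ℕ) → Q.Op (pow A n)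
  | 0 => (1 : Q.Op Q.one)
  | n + 1 => tensorOp (opPow X n) X

end Systems

/-! ### Quantum resource theories -/

/-- A finite-dimensional quantum resource theory: a compact set `S A` of states of interest of
each system `A`, and a compact set `O A B` of free operations for each pair of
systems, which are CPTP maps carrying `S A` into `S B`. Free operations are closed under
composition and tensor products, and the identity and the trace are free. The fields `assoc_mem` to
`right_unit_symm_mem` say that the free operations do not distinguish `(A ⊗ B) ⊗ C` from
`A ⊗ (B ⊗ C)`, nor `ℂ ⊗ A` and `A ⊗ ℂ` from `A`: the canonical identifications between
these are the identity map. -/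
structure QRT extends Systems.{u, v} where
  S : ∀ A : Sys, Set (toSystems.Op A)
  S_density : ∀ A, ∀ ψ ∈ S A, IsDensity ψ
  S_compact : ∀ A, IsCompact (S A)
  O : ∀ A B : Sys, Set (toSystems.Op A →ₗ[ℂ] toSystems.Op B)
  O_cptp : ∀ A B, ∀ N ∈ O A B, IsCPTP N
  O_mapsTo : ∀ A B, ∀ N ∈ O A B, ∀ ψ ∈ S A, N ψ ∈ S B
  /-- Compactness in the topology of pointwise convergence, which is the usual topology of the
  finite-dimensional space of linear maps. -/
  O_compact : ∀ A B, IsCompact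
    ((fun (N : toSystems.Op A →ₗ[ℂ] toSystems.Op B) (X : toSystems.Op A) => N X) '' O A B)
  comp_mem : ∀ A B C, ∀ M ∈ O A B, ∀ N ∈ O B C, N ∘ₗ M ∈ O A C
  tensor_mem : ∀ A₁ B₁ A₂ B₂, ∀ M ∈ O A₁ B₁, ∀ N ∈ O A₂ B₂,
    Systems.tensorHom M N ∈ O (tensor A₁ A₂) (tensor B₁ B₂)
  id_mem : ∀ A, LinearMap.id ∈ O A A
  trace_mem : ∀ A, Systems.traceHom A ∈ O A one
  assoc_mem : ∀ A B C, relabel (Systems.assocIdx A B C) ∈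
    O (tensor (tensor A B) C) (tensor A (tensor B C))
  assoc_symm_mem : ∀ A B C, relabel (Systems.assocIdx A B C).symm ∈
    O (tensor A (tensor B C)) (tensor (tensor A B) C)
  left_unit_mem : ∀ A, relabel (Systems.leftUnitIdx A) ∈ O (tensor one A) A
  left_unit_symm_mem : ∀ A, relabel (Systems.leftUnitIdx A).symm ∈ O A (tensor one A)
  right_unit_mem : ∀ A, relabel (Systems.rightUnitIdx A) ∈ O (tensor A one) A
  right_unit_symm_mem : ∀ A, relabel (Systems.rightUnitIdx A).symm ∈ O A (tensor A one)

namespace QRT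

open Systems

variable (Q : QRT.{u, v})

/-- A QRT is convex if its sets of free operations are convex. -/
def IsConvex : Prop :=
  ∀ A B : Q.Sys, Convex ℝ (Q.O A B)

/-- The free states of `A`: those obtainable from every state of every system by
a free operation. -/
def freeStates (A : Q.Sys) : Set (Q.Op A) :=
  {ψ | ψ ∈ Q.S A ∧ ∀ (B : Q.Sys), ∀ φ ∈ Q.S B, ∃ N ∈ Q.O B A, ψ = N φ}

/-- Every system has a free state of full rank. -/
def HasFullRankFreeStates : Prop :=
  ∀ A : Q.Sys, ∃ σ ∈ Q.freeStates A, σ.rank = Fintype.card (Q.idx A)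

/-- The achievable rates `r ≥ 0` of asymptotic conversion from `φ` to `ψ`. -/
def achievableRates {A B : Q.Sys} (φ : Q.S A) (ψ : Q.S B) : Set ℝ :=
  {r | 0 ≤ r ∧ ∃ N : (n : ℕ) → Q.Op (pow A n) →ₗ[ℂ] Q.Op (pow B ⌈r * n⌉₊),
    (∀ n, N n ∈ Q.O (pow A n) (pow B ⌈r * n⌉₊)) ∧
    liminf (fun n => traceNorm (N n (opPow φ.1 n) - opPow ψ.1 ⌈r * n⌉₊)) atTop = 0}

/-- The asymptotic conversion rate `r_conv(φ → ψ)`, which may be `+∞`. -/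
def conversionRate {A B : Q.Sys} (φ : Q.S A) (ψ : Q.S B) : EReal :=
  ⨆ r ∈ Q.achievableRates φ ψ, (r : EReal)

/-- A resource measure is a family of real functions on the sets of states that is monotone
under free operations. -/
def IsResourceMeasure (R : (A : Q.Sys) → Q.S A → ℝ) : Prop :=
  ∀ (A B : Q.Sys) (N : Q.Op A →ₗ[ℂ] Q.Op B) (hN : N ∈ Q.O A B) (ψ : Q.S A),
    R B ⟨N ψ.1, Q.O_mapsTo A B N hN ψ.1 ψ.2⟩ ≤ R A ψ

/-- A consistent resource measure: `R(ψ) r_conv(φ → ψ) ≤ R(φ)` for all states, in the extended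
reals with `0 * ∞ = 0`. -/
def IsConsistentResourceMeasure (R : (A : Q.Sys) → Q.S A → ℝ) : Prop :=
  Q.IsResourceMeasure R ∧
  ∀ (A B : Q.Sys) (ψ : Q.S A) (φ : Q.S B),
    (R A ψ : EReal) * Q.conversionRate φ ψ ≤ (R B φ : EReal)

/-- The relative entropy of resource `inf_{σ free} D(ρ‖σ)`. -/
def relEntropyOfResource {A : Q.Sys} (ρ : Q.Op A) : EReal :=
  ⨅ σ ∈ Q.freeStates A, relEntropy ρ σ

/-- `R` is the regularized relative entropy of resource: for every state `ψ` the limit of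
`R_R(ψ^{⊗ n}) / n` exists, and it is the real number `R(ψ)`. -/
def IsRegularizedRelEntropy (R : (A : Q.Sys) → Q.S A → ℝ) : Prop :=
  ∀ (A : Q.Sys) (ψ : Q.S A),
    Tendsto (fun n : ℕ => Q.relEntropyOfResource (opPow ψ.1 n) / (n : EReal)) atTop
      (𝓝 (R A ψ : EReal))

end QRT

end QuantumResource

end

/-! Write R for the relative entropy of resource. Tensor products of free states are free and D is
additive on products, so n ↦ R(ψ^{⊗ n}) is subadditive. Full-rank free states make it finite,
Klein's inequality makes it nonnegative, and Fekete's lemma gives the limit R^∞. Data processing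
under N^{⊗ n} makes R^∞ monotone.

Consistency rests on asymptotic continuity, `realRelEnt_le_add_traceNorm`: on A^{⊗ m} one has R(ψ) ≤
R(ρ) + 2 + ε m K, where ε = ‖ρ - ψ‖₁ / 2 and K depends on A only. If N_n achieves the rate r and m =
⌈r n⌉, then m R^∞(ψ) ≤ R(ψ^{⊗ m}) ≤ R(N_n(φ^{⊗ n})) + 2 + ε_n m K ≤ R(φ^{⊗ n}) + 2 + ε_n m K. For
every η > 0 infinitely many n have ε_n < η; divide by n, let n → ∞ and then η → 0. The constant 2
does not vanish with ε, but disappears after division by n. The continuity estimate itself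
(`relEnt_half_add_half_le`) mixes a free σ in equal parts with τ^{⊗ m}, τ free of full rank; this is
where convexity enters.

Data processing and joint subadditivity come from one principle, `relEnt_le_sum_of_variational`. If
ker σ ⊆ ker ρ, then D(ρ‖σ) is, in natural units, the limit for s → ∞ of ∫₀ˢ ⟨ρ, (L_σ + u R_ρ)⁻¹ ρ⟩
du - tr ρ log s, and the integrand is the maximum over X of 2 Re tr X†ρ minus the quadratic form
`modularForm`. A map of test operators from the target to the sources that does not decrease the
linear term, nor increase the quadratic one, compares the integrands and hence the entropies. The
dual of a channel is such a map by a Schwarz inequality; the identity is one for sums. -/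

set_option linter.unusedSectionVars false

noncomputable section

namespace QuantumResource

open Matrix

/-! ### Diagonalizations of Hermitian matrices -/

section Diagonalization

variable {ι κ : Type*} [Fintype ι] [DecidableEq ι] [Fintype κ] [DecidableEq κ]

/-- `A = U diag(d) U†` with `U` unitary and `d` real. -/
structure Diagonalizes (U : Matrix ι ι ℂ) (d : ι → ℝ) (A : Matrix ι ι ℂ) : Prop where
  conjTranspose_mul : Uᴴ * U = 1
  mul_conjTranspose : U * Uᴴ = 1
  eq : A = U * diagonal (fun i => (d i : ℂ)) * Uᴴ

theorem exists_diagonalizes {A : Matrix ι ι ℂ} (hA : A.IsHermitian) :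
    Diagonalizes (hA.eigenvectorUnitary : Matrix ι ι ℂ) hA.eigenvalues A :=
  ⟨Unitary.coe_star_mul_self _, Unitary.coe_mul_star_self _, hA.spectral_theorem⟩

namespace Diagonalizes

variable {U : Matrix ι ι ℂ} {d : ι → ℝ} {A : Matrix ι ι ℂ}

theorem mul_eq (h : Diagonalizes U d A) : A * U = U * diagonal (fun i => (d i : ℂ)) := by
  rw [h.eq, Matrix.mul_assoc, h.conjTranspose_mul, Matrix.mul_one]

theorem conjTranspose_mul_eq (h : Diagonalizes U d A) :
    Uᴴ * A = diagonal (fun i => (d i : ℂ)) * Uᴴ := by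
  rw [h.eq, ← Matrix.mul_assoc, ← Matrix.mul_assoc, h.conjTranspose_mul, Matrix.one_mul]

theorem isHermitian (h : Diagonalizes U d A) : A.IsHermitian := by
  rw [h.eq]
  refine isHermitian_mul_mul_conjTranspose U ?_
  rw [IsHermitian, diagonal_conjTranspose]
  congr 1
  ext i
  simp

theorem posSemidef (h : Diagonalizes U d A) (hd : ∀ i, 0 ≤ d i) : A.PosSemidef := by
  rw [h.eq]
  refine PosSemidef.mul_mul_conjTranspose_same (PosSemidef.diagonal fun i => ?_) U
  exact Complex.zero_le_real.2 (hd i)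

theorem trace_eq (h : Diagonalizes U d A) : A.trace = ∑ i, (d i : ℂ) := by
  rw [h.eq, trace_mul_cycle, h.conjTranspose_mul, Matrix.one_mul, trace_diagonal]

theorem apply_eq (h : Diagonalizes U d A) (i : ι) : (d i : ℂ) = (Uᴴ * A * U) i i := by
  rw [h.conjTranspose_mul_eq, Matrix.mul_assoc, h.conjTranspose_mul, Matrix.mul_one,
    diagonal_apply_eq]

theorem nonneg (h : Diagonalizes U d A) (hA : A.PosSemidef) (i : ι) : 0 ≤ d i := by
  have := (hA.conjTranspose_mul_mul_same U).diag_nonneg (i := i)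
  rw [← h.apply_eq] at this
  exact Complex.zero_le_real.1 this

/-- The unitary V†U between two eigenbases intertwines the diagonal matrices, so its entries vanish
unless the eigenvalues agree; hence it also intertwines their images under f. Thus product bases may
be used for Kronecker products. -/
theorem cfc_eq (h : Diagonalizes U d A) (f : ℝ → ℝ) :
    cfc f A = U * diagonal (fun i => (f (d i) : ℂ)) * Uᴴ := by
  have hA := h.isHermitian
  have h' := exists_diagonalizes hA
  set V : Matrix ι ι ℂ := (hA.eigenvectorUnitary : Matrix ι ι ℂ) with hV
  set e := hA.eigenvalues with he
  have h1 : cfc f A = V * diagonal (fun i => (f (e i) : ℂ)) * Vᴴ := hA.cfc_eq f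
  have h2 : diagonal (fun i => (e i : ℂ)) * (Vᴴ * U) =
      (Vᴴ * U) * diagonal (fun i => (d i : ℂ)) := by
    rw [← Matrix.mul_assoc, ← h'.conjTranspose_mul_eq, Matrix.mul_assoc, h.mul_eq,
      Matrix.mul_assoc]
  have h3 : diagonal (fun i => (f (e i) : ℂ)) * (Vᴴ * U) =
      (Vᴴ * U) * diagonal (fun i => (f (d i) : ℂ)) := by
    ext i j
    have := congrFun (congrFun h2 i) j
    rw [diagonal_mul, mul_diagonal] at this ⊢
    by_cases h0 : (Vᴴ * U) i j = 0
    · simp [h0]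
    · rw [mul_comm] at this
      have := mul_left_cancel₀ h0 this
      rw [Complex.ofReal_inj] at this
      rw [this, mul_comm]
  calc cfc f A = V * diagonal (fun i => (f (e i) : ℂ)) * Vᴴ := h1
    _ = V * (diagonal (fun i => (f (e i) : ℂ)) * (Vᴴ * U)) * Uᴴ := by
      simp only [Matrix.mul_assoc, h.mul_conjTranspose, Matrix.mul_one]
    _ = (V * Vᴴ) * (U * diagonal (fun i => (f (d i) : ℂ)) * Uᴴ) := by
      rw [h3]; simp only [Matrix.mul_assoc]
    _ = _ := by rw [h'.mul_conjTranspose, Matrix.one_mul]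

theorem kronecker {W : Matrix κ κ ℂ} {e : κ → ℝ} {B : Matrix κ κ ℂ} (hA : Diagonalizes U d A)
    (hB : Diagonalizes W e B) :
    Diagonalizes (U ⊗ₖ W) (fun x : ι × κ => d x.1 * e x.2) (A ⊗ₖ B) where
  conjTranspose_mul := by
    rw [conjTranspose_kronecker, ← mul_kronecker_mul, hA.conjTranspose_mul, hB.conjTranspose_mul,
      one_kronecker_one]
  mul_conjTranspose := by
    rw [conjTranspose_kronecker, ← mul_kronecker_mul, hA.mul_conjTranspose, hB.mul_conjTranspose,
      one_kronecker_one]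
  eq := by
    rw [hA.eq, hB.eq, mul_kronecker_mul, mul_kronecker_mul, conjTranspose_kronecker,
      diagonal_kronecker_diagonal]
    simp

theorem smul (h : Diagonalizes U d A) (c : ℝ) :
    Diagonalizes U (fun i => c * d i) ((c : ℂ) • A) where
  conjTranspose_mul := h.conjTranspose_mul
  mul_conjTranspose := h.mul_conjTranspose
  eq := by
    have : diagonal (fun i => ((c * d i : ℝ) : ℂ)) = (c : ℂ) • diagonal (fun i => (d i : ℂ)) := by
      ext i j
      by_cases hij : i = j <;> simp [diagonal, hij]
    rw [this, Matrix.mul_smul, Matrix.smul_mul, ← h.eq]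

theorem of_eigenvalues (h : Diagonalizes U d A) (e : ι → ℝ) :
    Diagonalizes U e (U * diagonal (fun i => (e i : ℂ)) * Uᴴ) :=
  ⟨h.conjTranspose_mul, h.mul_conjTranspose, rfl⟩

end Diagonalizes

/-- The squared modulus `|⟨v_j, u_i⟩|²` of the overlap of two basis vectors. -/
def overlap (U V : Matrix ι ι ℂ) (i j : ι) : ℝ :=
  Complex.normSq ((Vᴴ * U) j i)

theorem overlap_nonneg (U V : Matrix ι ι ℂ) (i j : ι) : 0 ≤ overlap U V i j :=
  Complex.normSq_nonneg _

theorem trace_conjTranspose_mul_mul_diagonal (X Y : Matrix ι ι ℂ) (p : ι → ℂ) :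
    (Xᴴ * Y * diagonal p).trace = ∑ i, ∑ j, star (X j i) * Y j i * p i := by
  refine Finset.sum_congr rfl fun i _ => ?_
  rw [diag_apply, mul_diagonal, mul_apply, Finset.sum_mul]
  rfl

theorem sum_overlap_left {U V : Matrix ι ι ℂ} (hU : Uᴴ * U = 1) (hV : V * Vᴴ = 1) (i : ι) :
    ∑ j, overlap U V i j = 1 := by
  have h : ((Vᴴ * U)ᴴ * (Vᴴ * U)) i i = 1 := by
    rw [conjTranspose_mul, conjTranspose_conjTranspose, Matrix.mul_assoc, ← Matrix.mul_assoc V,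
      hV, Matrix.one_mul, hU, one_apply_eq]
  rw [mul_apply] at h
  have h2 : ((∑ j, overlap U V i j : ℝ) : ℂ) = 1 := by
    rw [← h, Complex.ofReal_sum]
    refine Finset.sum_congr rfl fun j _ => ?_
    rw [overlap, Complex.normSq_eq_conj_mul_self]
    rfl
  exact_mod_cast h2

theorem trace_mul_cfc {U V : Matrix ι ι ℂ} {p q : ι → ℝ} {ρ σ : Matrix ι ι ℂ}
    (hρ : Diagonalizes U p ρ) (hσ : Diagonalizes V q σ) (f : ℝ → ℝ) :
    (ρ * cfc f σ).trace.re = ∑ i, ∑ j, overlap U V i j * (p i * f (q j)) := by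
  have h1 : (ρ * cfc f σ).trace =
      ((diagonal (fun j => (f (q j) : ℂ)) * (Vᴴ * U))ᴴ * (Vᴴ * U) *
        diagonal (fun i => (p i : ℂ))).trace := by
    have hd : (diagonal (fun j => (f (q j) : ℂ)))ᴴ = diagonal (fun j => (f (q j) : ℂ)) := by
      rw [diagonal_conjTranspose]
      congr 1
      ext i
      simp
    rw [conjTranspose_mul, hd, conjTranspose_mul, conjTranspose_conjTranspose, hσ.cfc_eq, hρ.eq]
    calc (U * diagonal (fun i => (p i : ℂ)) * Uᴴ *
          (V * diagonal (fun j => (f (q j) : ℂ)) * Vᴴ)).trace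
        = ((U * diagonal (fun i => (p i : ℂ))) * (Uᴴ * V * diagonal (fun j => (f (q j) : ℂ))
          * Vᴴ)).trace := by simp only [Matrix.mul_assoc]
      _ = _ := by rw [trace_mul_comm]; simp only [Matrix.mul_assoc]
  rw [h1, trace_conjTranspose_mul_mul_diagonal, Complex.re_sum]
  refine Finset.sum_congr rfl fun i _ => ?_
  rw [Complex.re_sum]
  refine Finset.sum_congr rfl fun j _ => ?_
  rw [diagonal_mul, overlap]
  have : star ((f (q j) : ℂ) * (Vᴴ * U) j i) * (Vᴴ * U) j i * (p i : ℂ) =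
      ((Complex.normSq ((Vᴴ * U) j i) * (p i * f (q j)) : ℝ) : ℂ) := by
    rw [star_mul', Complex.ofReal_mul, Complex.normSq_eq_conj_mul_self]
    simp only [Complex.star_def, Complex.conj_ofReal]
    push_cast
    ring
  rw [this, Complex.ofReal_re]

theorem trace_mul_cfc_self {U : Matrix ι ι ℂ} {p : ι → ℝ} {ρ : Matrix ι ι ℂ}
    (hρ : Diagonalizes U p ρ) (f : ℝ → ℝ) :
    (ρ * cfc f ρ).trace.re = ∑ i, p i * f (p i) := by
  have h := hρ.cfc_eq f
  rw [h, ← Matrix.mul_assoc, ← Matrix.mul_assoc, hρ.mul_eq, Matrix.mul_assoc U,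
    diagonal_mul_diagonal, trace_mul_cycle, hρ.conjTranspose_mul, Matrix.one_mul, trace_diagonal,
    Complex.re_sum]
  simp

end Diagonalization

end QuantumResource

namespace QuantumResource

open Matrix

/-! ### Relative entropy in natural units -/

section RelEnt

variable {ι κ : Type*} [Fintype ι] [DecidableEq ι] [Fintype κ] [DecidableEq κ]

/-- The kernel of `σ` is contained in the kernel of `ρ`. -/
def KerLE (σ ρ : Matrix ι ι ℂ) : Prop :=
  ∀ w : ι → ℂ, σ.mulVec w = 0 → ρ.mulVec w = 0

/-- The relative entropy `tr ρ log ρ - tr ρ log σ`, meaningful if `KerLE σ ρ`. -/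
def relEnt (ρ σ : Matrix ι ι ℂ) : ℝ :=
  (ρ * cfc Real.log ρ).trace.re - (ρ * cfc Real.log σ).trace.re

/-- The quadratic form `⟨X, L_σ X + s R_ρ X⟩`. -/
def modularForm (ρ σ : Matrix ι ι ℂ) (s : ℝ) (X : Matrix ι ι ℂ) : ℝ :=
  (X * Xᴴ * σ).trace.re + s * (Xᴴ * X * ρ).trace.re

/-- The value `⟨ρ, (L_σ + s R_ρ)⁻¹ ρ⟩` in terms of spectral data. -/
def resolventSum (U V : Matrix ι ι ℂ) (p q : ι → ℝ) (s : ℝ) : ℝ :=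
  ∑ i, ∑ j, overlap U V i j * (p i ^ 2 / (q j + s * p i))

/-- The primitive of `resolventSum` in `s` which vanishes at `0`. -/
def logSum (U V : Matrix ι ι ℂ) (p q : ι → ℝ) (s : ℝ) : ℝ :=
  ∑ i, ∑ j, overlap U V i j * (p i * (Real.log (q j + s * p i) - Real.log (q j)))

/-! ### Spectral sums and the integral representation of the relative entropy -/

section Spectral

variable {U V : Matrix ι ι ℂ} {p q : ι → ℝ} {ρ σ : Matrix ι ι ℂ}

/-- As `overlap` sums to one over j, the quantum quantity becomes the classical relative entropy of
the weights `overlap U V i j * p i` and `overlap U V i j * q j`. Later estimates can then be made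
term by term. -/
theorem relEnt_eq_sum (hρ : Diagonalizes U p ρ) (hσ : Diagonalizes V q σ) :
    relEnt ρ σ = ∑ i, ∑ j, overlap U V i j * (p i * (Real.log (p i) - Real.log (q j))) := by
  rw [relEnt, trace_mul_cfc hρ hσ, trace_mul_cfc_self hρ, ← Finset.sum_sub_distrib]
  refine Finset.sum_congr rfl fun i _ => ?_
  rw [← one_mul (p i * Real.log (p i)),
    ← sum_overlap_left hρ.conjTranspose_mul hσ.mul_conjTranspose i, Finset.sum_mul,
    ← Finset.sum_sub_distrib]
  refine Finset.sum_congr rfl fun j _ => ?_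
  ring

/-- If q j = 0, then v_j lies in ker σ, hence in ker ρ, and p i ⟨u_i, v_j⟩ = 0. So the default value
log 0 = 0 never occurs in a term of nonzero weight. -/
theorem KerLE.eigenvalue_ne_zero (hk : KerLE σ ρ) (hρ : Diagonalizes U p ρ)
    (hσ : Diagonalizes V q σ) {i j : ι} (h : overlap U V i j * p i ≠ 0) : q j ≠ 0 := by
  intro hq
  have h1 : σ.mulVec (fun k => V k j) = 0 := by
    have := congrArg (fun M => fun k => M k j) hσ.mul_eq
    ext k
    have h2 := congrFun this k
    simp only [mul_diagonal, hq, Complex.ofReal_zero, mul_zero] at h2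
    rw [Pi.zero_apply, ← h2]
    rfl
  have h2 := hk _ h1
  have h3 : (Uᴴ * ρ * V) i j = 0 := by
    rw [Matrix.mul_assoc, mul_apply]
    refine Finset.sum_eq_zero fun k _ => ?_
    have : (ρ * V) k j = 0 := congrFun h2 k
    rw [this, mul_zero]
  rw [hρ.conjTranspose_mul_eq, Matrix.mul_assoc, diagonal_mul] at h3
  apply h
  rcases mul_eq_zero.1 h3 with h4 | h4
  · rw [Complex.ofReal_eq_zero.1 h4, mul_zero]
  · have : (Vᴴ * U) j i = 0 := by
      rw [← conjTranspose_conjTranspose (Vᴴ * U), conjTranspose_apply, conjTranspose_mul,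
        conjTranspose_conjTranspose, h4, star_zero]
    rw [overlap, this, map_zero, zero_mul]

theorem re_trace_conjTranspose_mul (hρ : Diagonalizes U p ρ) (hσ : Diagonalizes V q σ)
    (X : Matrix ι ι ℂ) :
    (Xᴴ * ρ).trace.re =
      ∑ i, ∑ j, (star ((Vᴴ * X * U) j i) * (Vᴴ * U) j i).re * p i := by
  have h : (Xᴴ * ρ).trace =
      ((Vᴴ * X * U)ᴴ * (Vᴴ * U) * diagonal (fun i => (p i : ℂ))).trace := by
    rw [hρ.eq, conjTranspose_mul, conjTranspose_mul, conjTranspose_conjTranspose]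
    calc (Xᴴ * (U * diagonal (fun i => (p i : ℂ)) * Uᴴ)).trace
        = (Xᴴ * (V * Vᴴ) * U * diagonal (fun i => (p i : ℂ)) * Uᴴ).trace := by
          rw [hσ.mul_conjTranspose, Matrix.mul_one]; simp only [Matrix.mul_assoc]
      _ = _ := by rw [trace_mul_comm]; simp only [Matrix.mul_assoc]
  rw [h, trace_conjTranspose_mul_mul_diagonal, Complex.re_sum]
  refine Finset.sum_congr rfl fun i _ => ?_
  rw [Complex.re_sum]
  refine Finset.sum_congr rfl fun j _ => ?_
  rw [mul_comm, Complex.re_ofReal_mul, mul_comm]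

theorem modularForm_eq_sum (hρ : Diagonalizes U p ρ) (hσ : Diagonalizes V q σ) (s : ℝ)
    (X : Matrix ι ι ℂ) :
    modularForm ρ σ s X =
      ∑ i, ∑ j, Complex.normSq ((Vᴴ * X * U) j i) * (q j + s * p i) := by
  have h1 : (Xᴴ * X * ρ).trace =
      ((Vᴴ * X * U)ᴴ * (Vᴴ * X * U) * diagonal (fun i => (p i : ℂ))).trace := by
    rw [hρ.eq, conjTranspose_mul, conjTranspose_mul, conjTranspose_conjTranspose]
    calc (Xᴴ * X * (U * diagonal (fun i => (p i : ℂ)) * Uᴴ)).trace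
        = (Xᴴ * (V * Vᴴ) * X * U * diagonal (fun i => (p i : ℂ)) * Uᴴ).trace := by
          rw [hσ.mul_conjTranspose, Matrix.mul_one]; simp only [Matrix.mul_assoc]
      _ = _ := by rw [trace_mul_comm]; simp only [Matrix.mul_assoc]
  have h2 : (X * Xᴴ * σ).trace =
      (((Vᴴ * X * U)ᴴ)ᴴ * (Vᴴ * X * U)ᴴ * diagonal (fun i => (q i : ℂ))).trace := by
    rw [hσ.eq, conjTranspose_conjTranspose, conjTranspose_mul, conjTranspose_mul,
      conjTranspose_conjTranspose]
    calc (X * Xᴴ * (V * diagonal (fun i => (q i : ℂ)) * Vᴴ)).trace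
        = (X * (U * Uᴴ) * Xᴴ * V * diagonal (fun i => (q i : ℂ)) * Vᴴ).trace := by
          rw [hρ.mul_conjTranspose, Matrix.mul_one]; simp only [Matrix.mul_assoc]
      _ = _ := by rw [trace_mul_comm]; simp only [Matrix.mul_assoc]
  have h3 : (Xᴴ * X * ρ).trace.re =
      ∑ i, ∑ j, Complex.normSq ((Vᴴ * X * U) j i) * p i := by
    rw [h1, trace_conjTranspose_mul_mul_diagonal, Complex.re_sum]
    refine Finset.sum_congr rfl fun i _ => ?_
    rw [Complex.re_sum]
    refine Finset.sum_congr rfl fun j _ => ?_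
    rw [Complex.star_def, ← Complex.normSq_eq_conj_mul_self, ← Complex.ofReal_mul,
      Complex.ofReal_re]
  have h4 : (X * Xᴴ * σ).trace.re =
      ∑ i, ∑ j, Complex.normSq ((Vᴴ * X * U) j i) * q j := by
    rw [h2, trace_conjTranspose_mul_mul_diagonal, Complex.re_sum, Finset.sum_comm]
    refine (Complex.re_sum _ _).symm.trans ?_
    rw [Finset.sum_comm, Complex.re_sum]
    rw [Finset.sum_comm]
    refine Finset.sum_congr rfl fun i _ => ?_
    rw [Complex.re_sum]
    refine Finset.sum_congr rfl fun j _ => ?_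
    rw [conjTranspose_apply, star_star, mul_comm ((Vᴴ * X * U) _ _), Complex.star_def,
      ← Complex.normSq_eq_conj_mul_self, ← Complex.ofReal_mul, Complex.ofReal_re]
  rw [modularForm, h3, h4, Finset.mul_sum, ← Finset.sum_add_distrib]
  refine Finset.sum_congr rfl fun i _ => ?_
  rw [Finset.mul_sum, ← Finset.sum_add_distrib]
  refine Finset.sum_congr rfl fun j _ => ?_
  ring

/-- In the two eigenbases the entries of X decouple. With t = q j + s * p i, each entry x with p i >
0 is handled by completing the square: 2 Re(x̄ c) p - |x|² t ≤ |c|² p² / t. -/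
theorem two_mul_trace_sub_modularForm_le (hρ : Diagonalizes U p ρ) (hσ : Diagonalizes V q σ)
    (hp : ∀ i, 0 ≤ p i) (hq : ∀ j, 0 ≤ q j) {s : ℝ} (hs : 0 < s) (X : Matrix ι ι ℂ) :
    2 * (Xᴴ * ρ).trace.re - modularForm ρ σ s X ≤ resolventSum U V p q s := by
  rw [re_trace_conjTranspose_mul hρ hσ, modularForm_eq_sum hρ hσ, resolventSum, Finset.mul_sum,
    ← Finset.sum_sub_distrib]
  refine Finset.sum_le_sum fun i _ => ?_
  rw [Finset.mul_sum, ← Finset.sum_sub_distrib]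
  refine Finset.sum_le_sum fun j _ => ?_
  generalize (Vᴴ * X * U) j i = x
  rw [overlap]
  generalize (Vᴴ * U) j i = c
  rcases (hp i).eq_or_lt with h | h
  · rw [← h]
    have := mul_nonneg (Complex.normSq_nonneg x) (hq j)
    simp
    exact this
  · have hpos : 0 < q j + s * p i := add_pos_of_nonneg_of_pos (hq j) (mul_pos hs h)
    rw [← mul_div_assoc, le_div_iff₀ hpos]
    simp only [Complex.star_def, Complex.mul_re, Complex.conj_re, Complex.conj_im,
      Complex.normSq_apply]
    nlinarith [sq_nonneg (x.re * (q j + s * p i) - c.re * p i),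
      sq_nonneg (x.im * (q j + s * p i) - c.im * p i)]

theorem exists_two_mul_trace_sub_modularForm_eq (hρ : Diagonalizes U p ρ)
    (hσ : Diagonalizes V q σ) (hp : ∀ i, 0 ≤ p i) (hq : ∀ j, 0 ≤ q j) {s : ℝ} (hs : 0 < s) :
    ∃ X : Matrix ι ι ℂ,
      2 * (Xᴴ * ρ).trace.re - modularForm ρ σ s X = resolventSum U V p q s := by
  -- The entrywise maximizer x = c p / t of the completed square.
  set Y : Matrix ι ι ℂ := Matrix.of fun j i => (Vᴴ * U) j i * ((p i / (q j + s * p i) : ℝ) : ℂ)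
    with hY
  have hX : Vᴴ * (V * Y * Uᴴ) * U = Y := by
    calc Vᴴ * (V * Y * Uᴴ) * U = (Vᴴ * V) * Y * (Uᴴ * U) := by simp only [Matrix.mul_assoc]
      _ = Y := by rw [hσ.conjTranspose_mul, hρ.conjTranspose_mul, Matrix.one_mul, Matrix.mul_one]
  refine ⟨V * Y * Uᴴ, ?_⟩
  rw [re_trace_conjTranspose_mul hρ hσ, modularForm_eq_sum hρ hσ, resolventSum, Finset.mul_sum,
    ← Finset.sum_sub_distrib, hX]
  refine Finset.sum_congr rfl fun i _ => ?_
  rw [Finset.mul_sum, ← Finset.sum_sub_distrib]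
  refine Finset.sum_congr rfl fun j _ => ?_
  rw [overlap, hY, of_apply]
  generalize (Vᴴ * U) j i = c
  rcases (hp i).eq_or_lt with h | h
  · rw [← h]
    simp
  · have hpos : 0 < q j + s * p i := add_pos_of_nonneg_of_pos (hq j) (mul_pos hs h)
    simp only [Complex.star_def, Complex.mul_re, Complex.conj_re, Complex.conj_im, Complex.mul_im,
      Complex.normSq_apply, Complex.ofReal_re, Complex.ofReal_im]
    generalize q j + s * p i = t at hpos ⊢
    field_simp
    ring

theorem logSum_zero : logSum U V p q 0 = 0 := by
  simp [logSum]

theorem continuousOn_logSum (hρ : Diagonalizes U p ρ) (hσ : Diagonalizes V q σ)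
    (hp : ∀ i, 0 ≤ p i) (hq : ∀ j, 0 ≤ q j) (hk : KerLE σ ρ) :
    ContinuousOn (logSum U V p q) (Set.Ici 0) := by
  unfold logSum
  refine continuousOn_finsetSum _ fun i _ => continuousOn_finsetSum _ fun j _ => ?_
  -- A term of nonzero weight has q j > 0, so its logarithm is continuous down to s = 0.
  by_cases h : overlap U V i j * p i = 0
  · simp only [← mul_assoc, h, zero_mul]
    exact continuousOn_const
  · have hq' : 0 < q j := (hq j).lt_of_ne (hk.eigenvalue_ne_zero hρ hσ h).symm
    refine continuousOn_const.mul (continuousOn_const.mul (ContinuousOn.sub ?_ continuousOn_const))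
    refine ContinuousOn.log (by fun_prop) fun s hs => ?_
    exact (add_pos_of_pos_of_nonneg hq' (mul_nonneg hs (hp i))).ne'

theorem hasDerivAt_logSum (hp : ∀ i, 0 ≤ p i) (hq : ∀ j, 0 ≤ q j) {s : ℝ} (hs : 0 < s) :
    HasDerivAt (logSum U V p q) (resolventSum U V p q s) s := by
  unfold logSum resolventSum
  refine HasDerivAt.fun_sum fun i _ => HasDerivAt.fun_sum fun j _ => ?_
  refine HasDerivAt.const_mul _ ?_
  rcases (hp i).eq_or_lt with h | h
  · rw [← h]
    simpa using hasDerivAt_const s (0 : ℝ)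
  · have hpos : 0 < q j + s * p i := add_pos_of_nonneg_of_pos (hq j) (mul_pos hs h)
    have h1 : HasDerivAt (fun s => q j + s * p i) (p i) s := by
      simpa using ((hasDerivAt_id s).mul_const (p i)).const_add (q j)
    have h2 := ((h1.log hpos.ne').sub_const (Real.log (q j))).const_mul (p i)
    convert h2 using 1
    ring

/-- For p, q > 0, log (q + s p) - log s tends to log p, and the weights of the subtracted log s add
up to tr ρ. Together with the derivative of `logSum` and its value at 0, this is the integral
representation. -/
theorem tendsto_logSum_sub (hρ : Diagonalizes U p ρ) (hσ : Diagonalizes V q σ)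
    (hp : ∀ i, 0 ≤ p i) (hq : ∀ j, 0 ≤ q j) (hk : KerLE σ ρ) :
    Tendsto (fun s => logSum U V p q s - ρ.trace.re * Real.log s) atTop (𝓝 (relEnt ρ σ)) := by
  have h1 : ∀ s, logSum U V p q s - ρ.trace.re * Real.log s =
      ∑ i, ∑ j, overlap U V i j *
        (p i * (Real.log (q j + s * p i) - Real.log s - Real.log (q j))) := by
    intro s
    have : ρ.trace.re = ∑ i, ∑ j, overlap U V i j * p i := by
      rw [hρ.trace_eq, Complex.re_sum]
      refine Finset.sum_congr rfl fun i _ => ?_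
      rw [← Finset.sum_mul, sum_overlap_left hρ.conjTranspose_mul hσ.mul_conjTranspose, one_mul,
        Complex.ofReal_re]
    rw [this, logSum, Finset.sum_mul, ← Finset.sum_sub_distrib]
    refine Finset.sum_congr rfl fun i _ => ?_
    rw [Finset.sum_mul, ← Finset.sum_sub_distrib]
    refine Finset.sum_congr rfl fun j _ => ?_
    ring
  simp only [h1]
  rw [relEnt_eq_sum hρ hσ]
  refine tendsto_finsetSum _ fun i _ => tendsto_finsetSum _ fun j _ => ?_
  by_cases h : overlap U V i j * p i = 0
  · simp only [← mul_assoc, h, zero_mul]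
    exact tendsto_const_nhds
  · have hq' : 0 < q j := (hq j).lt_of_ne (hk.eigenvalue_ne_zero hρ hσ h).symm
    have hp' : 0 < p i := (hp i).lt_of_ne fun h' => h (by rw [← h', mul_zero])
    refine Tendsto.const_mul _ (Tendsto.const_mul _ (Tendsto.sub_const ?_ _))
    have h2 : Tendsto (fun s : ℝ => Real.log (q j / s + p i)) atTop (𝓝 (Real.log (p i))) := by
      have : Tendsto (fun s : ℝ => q j / s + p i) atTop (𝓝 (0 + p i)) :=
        (tendsto_const_nhds.div_atTop tendsto_id).add_const _
      rw [zero_add] at this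
      exact this.log hp'.ne'
    refine h2.congr' ?_
    filter_upwards [eventually_gt_atTop 0] with s hs
    rw [← Real.log_div (add_pos hq' (mul_pos hs hp')).ne' hs.ne']
    congr 1
    field_simp

end Spectral

end RelEnt

end QuantumResource
namespace QuantumResource

open Matrix

/-! ### Monotonicity by comparison of variational problems -/

section RelEnt

variable {ι κ : Type*} [Fintype ι] [DecidableEq ι] [Fintype κ] [DecidableEq κ]

/-- Test with Y = |w⟩⟨w| for w in ker σ'. The quadratic bound forces σ_a T(Y)_a = 0, hence ρ_a
T(Y)_a = 0, and the linear bound leaves ⟨w, ρ' w⟩ ≤ 0. -/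
theorem KerLE.of_variational {α : Type*} [Fintype α] {ρ' σ' : Matrix κ κ ℂ}
    {ρ σ : α → Matrix ι ι ℂ} (hρ' : ρ'.PosSemidef)
    (hρ : ∀ a, (ρ a).PosSemidef) (hσ : ∀ a, (σ a).PosSemidef)
    (hk : ∀ a, KerLE (σ a) (ρ a)) (T : Matrix κ κ ℂ → α → Matrix ι ι ℂ)
    (h1 : ∀ Y, (Yᴴ * ρ').trace.re ≤ ∑ a, ((T Y a)ᴴ * ρ a).trace.re)
    (h2 : ∀ Y, ∑ a, (T Y a * (T Y a)ᴴ * σ a).trace.re ≤ (Y * Yᴴ * σ').trace.re) :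
    KerLE σ' ρ' := by
  intro w hw
  set Y : Matrix κ κ ℂ := vecMulVec w (star w) with hY
  have hYσ : σ' * Y = 0 := by rw [hY, mul_vecMulVec, hw, zero_vecMulVec]
  have h3 : (Y * Yᴴ * σ').trace.re = 0 := by
    rw [trace_mul_comm, ← Matrix.mul_assoc, hYσ, Matrix.zero_mul, trace_zero, Complex.zero_re]
  have hX : ∀ a, (T Y a * (T Y a)ᴴ * σ a).trace = ((T Y a)ᴴ * σ a * T Y a).trace := by
    intro a
    rw [Matrix.mul_assoc, trace_mul_comm]
  have hpos : ∀ a, ((T Y a)ᴴ * σ a * T Y a).PosSemidef :=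
    fun a => (hσ a).conjTranspose_mul_mul_same _
  have h4 : ∀ a, ρ a * T Y a = 0 := by
    have hsum : ∑ a, (T Y a * (T Y a)ᴴ * σ a).trace.re = 0 := by
      refine le_antisymm (h3 ▸ h2 Y) (Finset.sum_nonneg fun a _ => ?_)
      rw [hX]
      exact (Complex.nonneg_iff.1 (hpos a).trace_nonneg).1
    intro a
    have h5 := (Finset.sum_eq_zero_iff_of_nonneg fun a _ => by
      rw [hX]
      exact (Complex.nonneg_iff.1 (hpos a).trace_nonneg).1).1 hsum a (Finset.mem_univ a)
    rw [hX] at h5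
    have h6 : ((T Y a)ᴴ * σ a * T Y a).trace = 0 :=
      Complex.ext h5 (Complex.nonneg_iff.1 (hpos a).trace_nonneg).2.symm
    rw [(hpos a).trace_eq_zero_iff] at h6
    have h7 : ∀ k, (σ a).mulVec (fun l => T Y a l k) = 0 := by
      intro k
      rw [← (hσ a).dotProduct_mulVec_zero_iff]
      have h8 := congrFun (congrFun h6 k) k
      rw [Matrix.mul_assoc] at h8
      exact h8
    ext i k
    exact congrFun (hk a _ (h7 k)) i
  have h5 : (Yᴴ * ρ').trace.re ≤ 0 := by
    refine (h1 Y).trans (Finset.sum_nonpos fun a _ => le_of_eq ?_)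
    have h6 := congrArg conjTranspose (h4 a)
    rw [conjTranspose_mul, (hρ a).1, conjTranspose_zero] at h6
    rw [h6, trace_zero, Complex.zero_re]
  rw [← hρ'.dotProduct_mulVec_zero_iff]
  have h6 : (Yᴴ * ρ').trace = star w ⬝ᵥ ρ'.mulVec w := by
    rw [trace_mul_comm, hY, conjTranspose_vecMulVec, star_star, mul_vecMulVec, trace_vecMulVec,
      dotProduct_comm]
  have h7 := hρ'.dotProduct_mulVec_nonneg w
  rw [h6] at h5
  exact Complex.ext (le_antisymm h5 (Complex.nonneg_iff.1 h7).1) (Complex.nonneg_iff.1 h7).2.symm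


/-- Monotonicity of the relative entropy, in the form which covers data processing and joint
convexity. -/
theorem relEnt_le_sum_of_variational {α : Type*} [Fintype α] {ρ' σ' : Matrix κ κ ℂ}
    {ρ σ : α → Matrix ι ι ℂ} (hρ' : ρ'.PosSemidef) (hσ' : σ'.PosSemidef)
    (hρ : ∀ a, (ρ a).PosSemidef) (hσ : ∀ a, (σ a).PosSemidef)
    (hk : ∀ a, KerLE (σ a) (ρ a)) (htr : ρ'.trace.re = ∑ a, (ρ a).trace.re)
    (T : Matrix κ κ ℂ → α → Matrix ι ι ℂ)
    (h1 : ∀ Y, (Yᴴ * ρ').trace.re ≤ ∑ a, ((T Y a)ᴴ * ρ a).trace.re)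
    (h2 : ∀ Y, ∑ a, (T Y a * (T Y a)ᴴ * σ a).trace.re ≤ (Y * Yᴴ * σ').trace.re)
    (h3 : ∀ Y, ∑ a, ((T Y a)ᴴ * T Y a * ρ a).trace.re ≤ (Yᴴ * Y * ρ').trace.re) :
    relEnt ρ' σ' ≤ ∑ a, relEnt (ρ a) (σ a) := by
  have hk' : KerLE σ' ρ' := KerLE.of_variational hρ' hρ hσ hk T h1 h2
  have dρ' := exists_diagonalizes hρ'.1
  have dσ' := exists_diagonalizes hσ'.1
  have dρ := fun a => exists_diagonalizes (hρ a).1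
  have dσ := fun a => exists_diagonalizes (hσ a).1
  have hres : ∀ s : ℝ, 0 < s → resolventSum (hρ'.1.eigenvectorUnitary : Matrix κ κ ℂ)
      (hσ'.1.eigenvectorUnitary : Matrix κ κ ℂ) hρ'.1.eigenvalues hσ'.1.eigenvalues s ≤
      ∑ a, resolventSum ((hρ a).1.eigenvectorUnitary : Matrix ι ι ℂ)
        ((hσ a).1.eigenvectorUnitary : Matrix ι ι ℂ) (hρ a).1.eigenvalues
        (hσ a).1.eigenvalues s := by
    intro s hs
    obtain ⟨Y, hY⟩ := exists_two_mul_trace_sub_modularForm_eq dρ' dσ' (dρ'.nonneg hρ')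
      (dσ'.nonneg hσ') hs
    rw [← hY]
    refine le_trans ?_ (Finset.sum_le_sum fun a _ => two_mul_trace_sub_modularForm_le (dρ a) (dσ a)
      ((dρ a).nonneg (hρ a)) ((dσ a).nonneg (hσ a)) hs (T Y a))
    simp only [modularForm, Finset.sum_sub_distrib, Finset.sum_add_distrib, ← Finset.mul_sum]
    have := mul_le_mul_of_nonneg_left (h3 Y) hs.le
    linarith [h1 Y, h2 Y]
  -- The difference of the primitives vanishes at s = 0, and its derivative is the difference of the
  -- resolvent sums.
  have hmono : MonotoneOn (fun s => ∑ a, logSum ((hρ a).1.eigenvectorUnitary : Matrix ι ι ℂ)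
        ((hσ a).1.eigenvectorUnitary : Matrix ι ι ℂ) (hρ a).1.eigenvalues
        (hσ a).1.eigenvalues s - logSum (hρ'.1.eigenvectorUnitary : Matrix κ κ ℂ)
      (hσ'.1.eigenvectorUnitary : Matrix κ κ ℂ) hρ'.1.eigenvalues hσ'.1.eigenvalues s)
      (Set.Ici 0) := by
    have hderiv : ∀ s : ℝ, 0 < s → HasDerivAt _ _ s := fun s hs =>
      (HasDerivAt.fun_sum fun a (_ : a ∈ Finset.univ) =>
        hasDerivAt_logSum (U := ((hρ a).1.eigenvectorUnitary : Matrix ι ι ℂ))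
          (V := ((hσ a).1.eigenvectorUnitary : Matrix ι ι ℂ))
          ((dρ a).nonneg (hρ a)) ((dσ a).nonneg (hσ a)) hs).sub
        (hasDerivAt_logSum (U := (hρ'.1.eigenvectorUnitary : Matrix κ κ ℂ))
          (V := (hσ'.1.eigenvectorUnitary : Matrix κ κ ℂ))
          (dρ'.nonneg hρ') (dσ'.nonneg hσ') hs)
    refine monotoneOn_of_deriv_nonneg (convex_Ici 0) ?_ ?_ ?_
    · exact (continuousOn_finsetSum _ fun a _ => continuousOn_logSum (dρ a) (dσ a)
        ((dρ a).nonneg (hρ a)) ((dσ a).nonneg (hσ a)) (hk a)).sub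
        (continuousOn_logSum dρ' dσ' (dρ'.nonneg hρ') (dσ'.nonneg hσ') hk')
    · intro s hs
      rw [interior_Ici] at hs
      exact (hderiv s hs).differentiableAt.differentiableWithinAt
    · intro s hs
      rw [interior_Ici] at hs
      have := (hderiv s hs).deriv
      refine le_trans (sub_nonneg.2 (hres s hs)) (le_of_eq this.symm)
  refine le_of_tendsto_of_tendsto
    (tendsto_logSum_sub dρ' dσ' (dρ'.nonneg hρ') (dσ'.nonneg hσ') hk')
    (tendsto_finsetSum _ fun a _ => tendsto_logSum_sub (dρ a) (dσ a) ((dρ a).nonneg (hρ a))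
      ((dσ a).nonneg (hσ a)) (hk a)) ?_
  filter_upwards [eventually_ge_atTop 0] with s hs
  have := hmono (Set.mem_Ici.2 le_rfl) (Set.mem_Ici.2 hs) hs
  simp only [logSum_zero, Finset.sum_const_zero, sub_zero] at this
  -- Equal total traces make the counterterms tr ρ log s cancel.
  rw [Finset.sum_sub_distrib, ← Finset.sum_mul, ← htr]
  linarith

theorem relEnt_zero_left (σ : Matrix ι ι ℂ) : relEnt 0 σ = 0 := by
  simp [relEnt]

theorem KerLE.add {ρ₁ ρ₂ σ₁ σ₂ : Matrix ι ι ℂ} (hρ₁ : ρ₁.PosSemidef) (hρ₂ : ρ₂.PosSemidef)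
    (hσ₁ : σ₁.PosSemidef) (hσ₂ : σ₂.PosSemidef) (hk₁ : KerLE σ₁ ρ₁) (hk₂ : KerLE σ₂ ρ₂) :
    KerLE (σ₁ + σ₂) (ρ₁ + ρ₂) :=
  KerLE.of_variational (α := Bool) (ρ := fun b => if b then ρ₁ else ρ₂)
    (σ := fun b => if b then σ₁ else σ₂) (hρ₁.add hρ₂) (by simp [hρ₁, hρ₂]) (by simp [hσ₁, hσ₂])
    (by simp [hk₁, hk₂]) (fun Y _ => Y) (fun Y => by simp [Matrix.mul_add])
    (fun Y => by simp [Matrix.mul_add])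

/-- Joint subadditivity of the relative entropy. -/
theorem relEnt_add_le {ρ₁ ρ₂ σ₁ σ₂ : Matrix ι ι ℂ} (hρ₁ : ρ₁.PosSemidef) (hρ₂ : ρ₂.PosSemidef)
    (hσ₁ : σ₁.PosSemidef) (hσ₂ : σ₂.PosSemidef) (hk₁ : KerLE σ₁ ρ₁) (hk₂ : KerLE σ₂ ρ₂) :
    relEnt (ρ₁ + ρ₂) (σ₁ + σ₂) ≤ relEnt ρ₁ σ₁ + relEnt ρ₂ σ₂ := by
  have := relEnt_le_sum_of_variational (α := Bool) (ρ := fun b => if b then ρ₁ else ρ₂)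
    (σ := fun b => if b then σ₁ else σ₂) (hρ₁.add hρ₂) (hσ₁.add hσ₂) (by simp [hρ₁, hρ₂])
    (by simp [hσ₁, hσ₂]) (by simp [hk₁, hk₂]) (by simp) (fun Y _ => Y)
    (fun Y => by simp [Matrix.mul_add]) (fun Y => by simp [Matrix.mul_add])
    (fun Y => by simp [Matrix.mul_add])
  simpa using this

theorem KerLE.zero (σ : Matrix ι ι ℂ) : KerLE σ 0 := fun w _ => zero_mulVec w

/-- The relative entropy is antitone in its second argument. -/
theorem relEnt_add_right_le {ρ σ τ : Matrix ι ι ℂ} (hρ : ρ.PosSemidef) (hσ : σ.PosSemidef)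
    (hτ : τ.PosSemidef) (hk : KerLE σ ρ) : relEnt ρ (σ + τ) ≤ relEnt ρ σ := by
  have := relEnt_add_le hρ PosSemidef.zero hσ hτ hk (KerLE.zero τ)
  rwa [add_zero, relEnt_zero_left, add_zero] at this

/-! ### Data processing -/

theorem trace_relabel (e : ι ≃ κ) (X : Matrix ι ι ℂ) : (relabel e X).trace = X.trace := by
  simp only [relabel, LinearEquiv.coe_coe, coe_reindexLinearEquiv, reindex_apply, trace,
    diag_apply, submatrix_apply]
  exact Equiv.sum_comp e.symm fun i => X i i

theorem relabel_mul (e : ι ≃ κ) (X Y : Matrix ι ι ℂ) :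
    relabel e (X * Y) = relabel e X * relabel e Y := by
  simp [relabel]

theorem relabel_conjTranspose (e : ι ≃ κ) (X : Matrix ι ι ℂ) :
    relabel e Xᴴ = (relabel e X)ᴴ := by
  simp [relabel]

theorem relabel_relabel_symm (e : ι ≃ κ) (X : Matrix κ κ ℂ) :
    relabel e (relabel e.symm X) = X := by
  ext i j
  simp [relabel]

theorem posSemidef_relabel {e : ι ≃ κ} {X : Matrix ι ι ℂ} (hX : X.PosSemidef) :
    (relabel e X).PosSemidef :=
  hX.submatrix e.symm

/-- Test operators are carried back by the inverse relabelling, which turns all three comparisons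
into equalities. -/
theorem KerLE.relabel_relEnt {ρ σ : Matrix ι ι ℂ} (e : ι ≃ κ) (hρ : ρ.PosSemidef)
    (hσ : σ.PosSemidef) (hk : KerLE σ ρ) :
    KerLE (relabel e σ) (relabel e ρ) ∧ relEnt (relabel e ρ) (relabel e σ) ≤ relEnt ρ σ := by
  have key : ∀ X : Matrix κ κ ℂ, ∀ Z : Matrix ι ι ℂ,
      (X * relabel e Z).trace = (relabel e.symm X * Z).trace := by
    intro X Z
    rw [← trace_relabel e, relabel_mul, relabel_relabel_symm]
  have h1 : ∀ Y : Matrix κ κ ℂ, (Yᴴ * relabel e ρ).trace.re ≤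
      ∑ _a : Unit, ((relabel e.symm Y)ᴴ * ρ).trace.re := by
    intro Y
    simp [key, relabel_conjTranspose]
  have h2 : ∀ Y : Matrix κ κ ℂ, ∑ _a : Unit,
      (relabel e.symm Y * (relabel e.symm Y)ᴴ * σ).trace.re ≤
        (Y * Yᴴ * relabel e σ).trace.re := by
    intro Y
    simp [key, relabel_conjTranspose, relabel_mul]
  have h3 : ∀ Y : Matrix κ κ ℂ, ∑ _a : Unit,
      ((relabel e.symm Y)ᴴ * relabel e.symm Y * ρ).trace.re ≤
        (Yᴴ * Y * relabel e ρ).trace.re := by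
    intro Y
    simp [key, relabel_conjTranspose, relabel_mul]
  refine ⟨KerLE.of_variational (posSemidef_relabel hρ) (fun _ => hρ) (fun _ => hσ) (fun _ => hk)
    (fun Y _ => relabel e.symm Y) h1 h2, ?_⟩
  have := relEnt_le_sum_of_variational (posSemidef_relabel hρ) (posSemidef_relabel hσ)
    (fun _ => hρ) (fun _ => hσ) (fun _ => hk) (by simp [trace_relabel])
    (fun Y _ => relabel e.symm Y) h1 h2 h3
  simpa using this

/-- Stacking the W a into one operator Z, the blocks W a σ (W b)† form Z σ Z†, to which M ⊗ id is
applied. Two blocks suffice for compatibility with adjoints and for the Schwarz inequality. -/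
theorem IsCompletelyPositive.block {M : Matrix ι ι ℂ →ₗ[ℂ] Matrix κ κ ℂ}
    (hM : IsCompletelyPositive M) {σ : Matrix ι ι ℂ} (hσ : σ.PosSemidef) {d : ℕ}
    (W : Fin d → Matrix ι ι ℂ) :
    (Matrix.of fun x y : κ × Fin d => M (W x.2 * σ * (W y.2)ᴴ) x.1 y.1).PosSemidef := by
  set Z : Matrix (ι × Fin d) ι ℂ := Matrix.of fun x k => W x.2 x.1 k with hZ
  have h := hM d _ (hσ.mul_mul_conjTranspose_same Z)
  convert h using 1
  ext x y
  simp only [of_apply, tensorMap, LinearMap.coe_mk, AddHom.coe_mk, LinearMap.id_apply]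
  congr 2

theorem IsCompletelyPositive.posSemidef {M : Matrix ι ι ℂ →ₗ[ℂ] Matrix κ κ ℂ}
    (hM : IsCompletelyPositive M) {σ : Matrix ι ι ℂ} (hσ : σ.PosSemidef) : (M σ).PosSemidef := by
  have h := (hM.block hσ (d := 1) fun _ => 1).submatrix (fun i : κ => (i, 0))
  simp only [Matrix.one_mul, conjTranspose_one, Matrix.mul_one] at h
  exact h

theorem IsCompletelyPositive.map_mul_conjTranspose {M : Matrix ι ι ℂ →ₗ[ℂ] Matrix κ κ ℂ}
    (hM : IsCompletelyPositive M) {σ : Matrix ι ι ℂ} (hσ : σ.PosSemidef) (A : Matrix ι ι ℂ) :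
    M (σ * Aᴴ) = (M (A * σ))ᴴ := by
  have h := (hM.block hσ ![A, 1]).1
  ext i j
  have := congrFun (congrFun h (i, 1)) (j, 0)
  simp only [conjTranspose_apply, of_apply] at this
  simp at this
  rw [conjTranspose_apply, ← this]
  simp

theorem IsCompletelyPositive.map_conjTranspose {M : Matrix ι ι ℂ →ₗ[ℂ] Matrix κ κ ℂ}
    (hM : IsCompletelyPositive M) (A : Matrix ι ι ℂ) : M Aᴴ = (M A)ᴴ := by
  simpa using hM.map_mul_conjTranspose PosSemidef.one A

/-- The dual of a linear map with respect to the trace pairing. -/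
def dualMap (M : Matrix ι ι ℂ →ₗ[ℂ] Matrix κ κ ℂ) (Y : Matrix κ κ ℂ) : Matrix ι ι ℂ :=
  Matrix.of fun i j => (Y * M (Matrix.single j i 1)).trace

theorem trace_dualMap_mul (M : Matrix ι ι ℂ →ₗ[ℂ] Matrix κ κ ℂ) (Y : Matrix κ κ ℂ)
    (A : Matrix ι ι ℂ) : (dualMap M Y * A).trace = (Y * M A).trace := by
  conv_rhs => rw [matrix_eq_sum_single A]
  simp only [map_sum, Finset.mul_sum, trace_sum]
  simp only [trace, diag_apply, mul_apply (M := dualMap M Y)]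
  rw [Finset.sum_comm]
  refine Finset.sum_congr rfl fun i _ => Finset.sum_congr rfl fun j _ => ?_
  have : Matrix.single i j (A i j) = A i j • Matrix.single i j (1 : ℂ) := by simp
  rw [this, map_smul, Matrix.mul_smul, dualMap, of_apply]
  change _ = (A i j • (Y * M (Matrix.single i j 1))).trace
  rw [trace_smul, smul_eq_mul, mul_comm]

theorem IsCompletelyPositive.dualMap_conjTranspose {M : Matrix ι ι ℂ →ₗ[ℂ] Matrix κ κ ℂ}
    (hM : IsCompletelyPositive M) (Y : Matrix κ κ ℂ) : dualMap M Yᴴ = (dualMap M Y)ᴴ := by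
  ext i j
  have : Matrix.single j i (1 : ℂ) = (Matrix.single i j 1)ᴴ := by simp
  rw [conjTranspose_apply, dualMap, of_apply, dualMap, of_apply, this, hM.map_conjTranspose,
    ← conjTranspose_mul, trace_conjTranspose, trace_mul_comm]

omit [DecidableEq ι] [DecidableEq κ] in
theorem conjTranspose_block_mul_mul {d : ℕ} (B : Fin d → Fin d → Matrix κ κ ℂ)
    (V : Fin d → Matrix κ ι ℂ) :
    (Matrix.of fun (x : κ × Fin d) k => V x.2 x.1 k)ᴴ *
      (Matrix.of fun x y : κ × Fin d => B x.2 y.2 x.1 y.1) *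
      (Matrix.of fun (x : κ × Fin d) k => V x.2 x.1 k) = ∑ b, ∑ a, (V a)ᴴ * B a b * V b := by
  ext i j
  simp only [mul_apply, Matrix.sum_apply, conjTranspose_apply, of_apply, Fintype.sum_prod_type,
    Finset.sum_mul]
  rw [Finset.sum_comm]
  refine Finset.sum_congr rfl fun b _ => ?_
  exact (Finset.sum_congr rfl fun y _ => Finset.sum_comm).trans Finset.sum_comm

/-- The Schwarz inequality for the dual of a completely positive trace-preserving map. -/
theorem IsCPTP.schwarz {M : Matrix ι ι ℂ →ₗ[ℂ] Matrix κ κ ℂ} (hM : IsCPTP M)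
    {σ : Matrix ι ι ℂ} (hσ : σ.PosSemidef) (Y : Matrix κ κ ℂ) :
    (dualMap M Y * (dualMap M Y)ᴴ * σ).trace.re ≤ (Y * Yᴴ * M σ).trace.re := by
  set X := dualMap M Y with hX
  -- Compress the blocks by (1, -Y) and take the trace. By trace preservation and duality, three of
  -- the four terms are tr X X†σ, with signs +, -, -.
  have h := (hM.1.block hσ ![Xᴴ, 1]).conjTranspose_mul_mul_same
    (Matrix.of fun (x : κ × Fin 2) (k : κ) => (![1, -Y] : Fin 2 → Matrix κ κ ℂ) x.2 x.1 k)
  have h2 : (Matrix.of fun (x : κ × Fin 2) (k : κ) =>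
        (![1, -Y] : Fin 2 → Matrix κ κ ℂ) x.2 x.1 k)ᴴ *
      (Matrix.of fun x y : κ × Fin 2 => M ((![Xᴴ, 1] : Fin 2 → Matrix ι ι ℂ) x.2 * σ *
        ((![Xᴴ, 1] : Fin 2 → Matrix ι ι ℂ) y.2)ᴴ) x.1 y.1) *
      (Matrix.of fun (x : κ × Fin 2) (k : κ) => (![1, -Y] : Fin 2 → Matrix κ κ ℂ) x.2 x.1 k) =
      M (Xᴴ * σ * X) - M (Xᴴ * σ) * Y - Yᴴ * M (σ * X) + Yᴴ * M σ * Y := by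
    rw [conjTranspose_block_mul_mul (fun a b => M ((![Xᴴ, 1] : Fin 2 → Matrix ι ι ℂ) a * σ *
      ((![Xᴴ, 1] : Fin 2 → Matrix ι ι ℂ) b)ᴴ)) ![1, -Y]]
    simp only [Fin.sum_univ_two, cons_val_zero, cons_val_one, conjTranspose_one, Matrix.one_mul,
      Matrix.mul_one, conjTranspose_conjTranspose, conjTranspose_neg, Matrix.neg_mul,
      Matrix.mul_neg, neg_neg]
    abel
  rw [h2] at h
  have h3 := (Complex.nonneg_iff.1 h.trace_nonneg).1
  have h4 : (M (Xᴴ * σ * X)).trace = (X * Xᴴ * σ).trace := by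
    rw [hM.2, trace_mul_comm, Matrix.mul_assoc]
  have h5 : (M (Xᴴ * σ) * Y).trace = (X * Xᴴ * σ).trace := by
    rw [trace_mul_comm, ← trace_dualMap_mul, Matrix.mul_assoc]
  have h6 : (Yᴴ * M (σ * X)).trace = (X * Xᴴ * σ).trace := by
    rw [← trace_dualMap_mul, hM.1.dualMap_conjTranspose, ← Matrix.mul_assoc, trace_mul_cycle]
  have h7 : (Yᴴ * M σ * Y).trace = (Y * Yᴴ * M σ).trace := by
    rw [trace_mul_comm, Matrix.mul_assoc]
  rw [trace_add, trace_sub, trace_sub, h4, h5, h6, h7] at h3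
  simp only [Complex.add_re, Complex.sub_re] at h3
  linarith

/-- The data-processing inequality. -/
theorem IsCPTP.relEnt_le {M : Matrix ι ι ℂ →ₗ[ℂ] Matrix κ κ ℂ} (hM : IsCPTP M)
    {ρ σ : Matrix ι ι ℂ} (hρ : ρ.PosSemidef) (hσ : σ.PosSemidef) (hk : KerLE σ ρ) :
    KerLE (M σ) (M ρ) ∧ relEnt (M ρ) (M σ) ≤ relEnt ρ σ := by
  have h1 : ∀ Y : Matrix κ κ ℂ, (Yᴴ * M ρ).trace.re ≤
      ∑ _a : Unit, ((dualMap M Y)ᴴ * ρ).trace.re := by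
    intro Y
    rw [Fintype.sum_unique, ← hM.1.dualMap_conjTranspose, trace_dualMap_mul]
  have h2 : ∀ Y : Matrix κ κ ℂ, ∑ _a : Unit,
      (dualMap M Y * (dualMap M Y)ᴴ * σ).trace.re ≤ (Y * Yᴴ * M σ).trace.re := by
    intro Y
    rw [Fintype.sum_unique]
    exact hM.schwarz hσ Y
  have h3 : ∀ Y : Matrix κ κ ℂ, ∑ _a : Unit,
      ((dualMap M Y)ᴴ * dualMap M Y * ρ).trace.re ≤ (Yᴴ * Y * M ρ).trace.re := by
    intro Y
    -- The dual map commutes with adjoints, so the opposite order of factors is the Schwarz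
    -- inequality for Y†.
    have := hM.schwarz hρ Yᴴ
    rw [hM.1.dualMap_conjTranspose, conjTranspose_conjTranspose, conjTranspose_conjTranspose]
      at this
    rwa [Fintype.sum_unique]
  refine ⟨KerLE.of_variational (hM.1.posSemidef hρ) (fun _ => hρ) (fun _ => hσ) (fun _ => hk)
    (fun Y _ => dualMap M Y) h1 h2, ?_⟩
  have := relEnt_le_sum_of_variational (hM.1.posSemidef hρ) (hM.1.posSemidef hσ)
    (fun _ => hρ) (fun _ => hσ) (fun _ => hk) (by simp [hM.2])
    (fun Y _ => dualMap M Y) h1 h2 h3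
  simpa using this

end RelEnt
end QuantumResource

namespace QuantumResource

open Matrix

/-! ### Estimates for the relative entropy -/

section Estimates

variable {ι κ : Type*} [Fintype ι] [DecidableEq ι] [Fintype κ] [DecidableEq κ]
  {U V : Matrix ι ι ℂ} {p q : ι → ℝ} {ρ σ : Matrix ι ι ℂ}

theorem overlap_swap (U V : Matrix ι ι ℂ) (i j : ι) : overlap U V i j = overlap V U j i := by
  rw [overlap, overlap, ← Complex.normSq_conj]
  have : (starRingEnd ℂ) ((Vᴴ * U) j i) = ((Vᴴ * U)ᴴ) i j := rfl
  rw [this, conjTranspose_mul, conjTranspose_conjTranspose]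

theorem sum_overlap_right {U V : Matrix ι ι ℂ} (hU : U * Uᴴ = 1) (hV : Vᴴ * V = 1) (j : ι) :
    ∑ i, overlap U V i j = 1 := by
  simp only [overlap_swap U V]
  exact sum_overlap_left hV hU j

theorem KerLE.of_overlap (hρ : Diagonalizes U p ρ) (hσ : Diagonalizes V q σ)
    (h : ∀ i j, q j = 0 → overlap U V i j * p i = 0) : KerLE σ ρ := by
  intro w hw
  have h1 : ∀ j, (q j : ℂ) * (Vᴴ.mulVec w) j = 0 := by
    intro j
    have := congrArg (fun M => Matrix.mulVec M w j) hσ.conjTranspose_mul_eq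
    simp only [← mulVec_mulVec, hw, mulVec_zero, Pi.zero_apply, mulVec_diagonal] at this
    exact this.symm
  have h2 : w = V.mulVec (Vᴴ.mulVec w) := by
    rw [mulVec_mulVec, hσ.mul_conjTranspose, one_mulVec]
  have h3 : (diagonal (fun i => (p i : ℂ)) * (Uᴴ * V)).mulVec (Vᴴ.mulVec w) = 0 := by
    ext i
    rw [mulVec, dotProduct]
    refine Finset.sum_eq_zero fun j _ => ?_
    rw [diagonal_mul]
    by_cases hq : q j = 0
    · have h4 := h i j hq
      rw [overlap_swap, overlap, mul_eq_zero, Complex.normSq_eq_zero] at h4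
      rcases h4 with h4 | h4 <;> simp [h4]
    · rw [(mul_eq_zero.1 (h1 j)).resolve_left (by exact_mod_cast hq), mul_zero]
  have h5 : ρ.mulVec w = U.mulVec
      ((diagonal (fun i => (p i : ℂ)) * (Uᴴ * V)).mulVec (Vᴴ.mulVec w)) := by
    conv_lhs => rw [h2, hρ.eq]
    simp only [mulVec_mulVec, Matrix.mul_assoc]
  rw [h5, h3, mulVec_zero]

theorem KerLE.of_pos (hρ : ρ.IsHermitian) (hσ : Diagonalizes V q σ) (hq : ∀ j, 0 < q j) :
    KerLE σ ρ :=
  KerLE.of_overlap (exists_diagonalizes hρ) hσ fun _ j h => absurd h (hq j).ne'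

theorem Diagonalizes.re_trace_eq (h : Diagonalizes U p ρ) : ρ.trace.re = ∑ i, p i := by
  rw [h.trace_eq, ← Complex.ofReal_sum, Complex.ofReal_re]

/-- Klein's inequality. -/
theorem trace_mul_log_trace_le_relEnt (hρ : ρ.PosSemidef) (hσ : IsDensity σ) (hk : KerLE σ ρ) :
    ρ.trace.re * Real.log ρ.trace.re ≤ relEnt ρ σ := by
  have dρ := exists_diagonalizes hρ.1
  have dσ := exists_diagonalizes hσ.1.1
  have hp := dρ.nonneg hρ
  have hq := dσ.nonneg hσ.1
  generalize (hρ.1.eigenvectorUnitary : Matrix ι ι ℂ) = U at dρ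
  generalize (hσ.1.1.eigenvectorUnitary : Matrix ι ι ℂ) = V at dσ
  generalize hρ.1.eigenvalues = p at dρ hp
  generalize hσ.1.1.eigenvalues = q at dσ hq
  have hsp : ρ.trace.re = ∑ i, ∑ j, overlap U V i j * p i := by
    rw [dρ.re_trace_eq]
    refine Finset.sum_congr rfl fun i _ => ?_
    rw [← Finset.sum_mul, sum_overlap_left dρ.conjTranspose_mul dσ.mul_conjTranspose, one_mul]
  have hsq : (1 : ℝ) = ∑ i, ∑ j, overlap U V i j * q j := by
    have : σ.trace.re = 1 := by rw [hσ.2, Complex.one_re]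
    rw [← this, dσ.re_trace_eq, Finset.sum_comm]
    refine Finset.sum_congr rfl fun j _ => ?_
    rw [← Finset.sum_mul, sum_overlap_right dρ.mul_conjTranspose dσ.conjTranspose_mul, one_mul]
  set t := ρ.trace.re with ht
  have ht0 : 0 ≤ t := by rw [ht, dρ.re_trace_eq]; exact Finset.sum_nonneg fun i _ => hp i
  have key : ∑ i, ∑ j, (overlap U V i j * p i - t * (overlap U V i j * q j)) ≤
      ∑ i, ∑ j, (overlap U V i j * (p i * (Real.log (p i) - Real.log (q j))) -
        overlap U V i j * p i * Real.log t) := by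
    refine Finset.sum_le_sum fun i _ => Finset.sum_le_sum fun j _ => ?_
    have hw := overlap_nonneg U V i j
    by_cases h : overlap U V i j * p i = 0
    · have h2 := mul_nonneg ht0 (mul_nonneg hw (hq j))
      rw [← mul_assoc (overlap U V i j), h]
      linarith
    · have hq' : 0 < q j := (hq j).lt_of_ne (hk.eigenvalue_ne_zero dρ dσ h).symm
      have hp' : 0 < p i := (hp i).lt_of_ne fun h' => h (by rw [← h', mul_zero])
      have ht' : 0 < t := by
        rw [ht, dρ.re_trace_eq]
        exact Finset.sum_pos' (fun i _ => hp i) ⟨i, Finset.mem_univ i, hp'⟩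
      -- Use log x ≤ x - 1 at x = q j * t / p i: with σ scaled to the trace t of ρ, the linear
      -- remainders sum to zero.
      have h3 := Real.log_le_sub_one_of_pos (div_pos (mul_pos hq' ht') hp')
      rw [Real.log_div (mul_pos hq' ht').ne' hp'.ne', Real.log_mul hq'.ne' ht'.ne'] at h3
      have h4 := mul_le_mul_of_nonneg_left h3 hp'.le
      have h5 : p i * (q j * t / p i - 1) = q j * t - p i := by field_simp
      rw [h5] at h4
      have h6 := mul_le_mul_of_nonneg_left h4 hw
      linarith
  have e1 : ∑ i, ∑ j, (overlap U V i j * p i - t * (overlap U V i j * q j)) = t - t * 1 := by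
    calc _ = ∑ i, ∑ j, overlap U V i j * p i - t * ∑ i, ∑ j, overlap U V i j * q j := by
          simp only [Finset.sum_sub_distrib, Finset.mul_sum]
      _ = _ := by rw [← hsp, ← hsq]
  have e2 : ∑ i, ∑ j, (overlap U V i j * (p i * (Real.log (p i) - Real.log (q j))) -
      overlap U V i j * p i * Real.log t) = relEnt ρ σ - t * Real.log t := by
    rw [relEnt_eq_sum dρ dσ]
    calc _ = ∑ i, ∑ j, overlap U V i j * (p i * (Real.log (p i) - Real.log (q j))) -
          (∑ i, ∑ j, overlap U V i j * p i) * Real.log t := by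
          simp only [Finset.sum_sub_distrib, Finset.sum_mul]
      _ = _ := by rw [← hsp]
  rw [e1, e2] at key
  linarith

theorem relEnt_nonneg (hρ : IsDensity ρ) (hσ : IsDensity σ) (hk : KerLE σ ρ) :
    0 ≤ relEnt ρ σ := by
  have := trace_mul_log_trace_le_relEnt hρ.1 hσ hk
  rwa [hρ.2, Complex.one_re, Real.log_one, mul_zero] at this

/-- Every eigenvalue of the Hermitian matrix `σ` is at least `l`. -/
def EigenvaluesGE (l : ℝ) (σ : Matrix ι ι ℂ) : Prop :=
  ∃ (V : Matrix ι ι ℂ) (q : ι → ℝ), Diagonalizes V q σ ∧ ∀ j, l ≤ q j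

theorem EigenvaluesGE.kerLE {l : ℝ} (h : EigenvaluesGE l σ) (hl : 0 < l) (hρ : ρ.IsHermitian) :
    KerLE σ ρ := by
  obtain ⟨V, q, dσ, hq⟩ := h
  exact KerLE.of_pos hρ dσ fun j => hl.trans_le (hq j)

theorem EigenvaluesGE.kronecker {l m : ℝ} {τ : Matrix κ κ ℂ} (hσ : EigenvaluesGE l σ)
    (hτ : EigenvaluesGE m τ) (hl : 0 ≤ l) (hm : 0 ≤ m) : EigenvaluesGE (l * m) (σ ⊗ₖ τ) := by
  obtain ⟨V, q, dσ, hq⟩ := hσ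
  obtain ⟨W, r, dτ, hr⟩ := hτ
  exact ⟨_, _, dσ.kronecker dτ, fun x => mul_le_mul (hq x.1) (hr x.2) hm (hl.trans (hq x.1))⟩

theorem EigenvaluesGE.relabel {l : ℝ} (h : EigenvaluesGE l σ) (e : ι ≃ κ) :
    EigenvaluesGE l (relabel e σ) := by
  obtain ⟨V, q, dσ, hq⟩ := h
  have h1 : QuantumResource.relabel e (1 : Matrix ι ι ℂ) = 1 := by
    simp [QuantumResource.relabel]
  refine ⟨QuantumResource.relabel e V, fun k => q (e.symm k), ⟨?_, ?_, ?_⟩, fun k => hq _⟩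
  · rw [← relabel_conjTranspose, ← relabel_mul, dσ.conjTranspose_mul, h1]
  · rw [← relabel_conjTranspose, ← relabel_mul, dσ.mul_conjTranspose, h1]
  · conv_lhs => rw [dσ.eq]
    rw [relabel_mul, relabel_mul, relabel_conjTranspose]
    congr 2
    ext i j
    simp [QuantumResource.relabel, diagonal_apply]

theorem exists_eigenvaluesGE (hσ : σ.PosSemidef) (hr : σ.rank = Fintype.card ι) :
    ∃ l : ℝ, 0 < l ∧ l ≤ 1 ∧ EigenvaluesGE l σ := by
  have dσ := exists_diagonalizes hσ.1
  have hpos : ∀ j, 0 < hσ.1.eigenvalues j := by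
    intro j
    refine (dσ.nonneg hσ j).lt_of_ne fun h => ?_
    rw [hσ.1.rank_eq_card_non_zero_eigs] at hr
    exact (Fintype.card_subtype_lt (x := j) (by simpa using h.symm)).ne hr
  obtain ⟨l, hl, hl'⟩ : ∃ l : ℝ, 0 < l ∧ ∀ j, l ≤ hσ.1.eigenvalues j := by
    cases isEmpty_or_nonempty ι
    · exact ⟨1, one_pos, fun j => isEmptyElim j⟩
    · obtain ⟨j, hj⟩ := Finite.exists_min hσ.1.eigenvalues
      exact ⟨_, hpos j, hj⟩
  exact ⟨min l 1, lt_min hl one_pos, min_le_right _ _, _, _, dσ,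
    fun j => (min_le_left _ _).trans (hl' j)⟩

/-- Bound p i by the trace and q j below by l. The term t log t is kept because it cancels the one
of Klein's inequality in the continuity estimate. -/
theorem relEnt_le_of_eigenvaluesGE (hρ : ρ.PosSemidef) {l : ℝ} (hl : 0 < l)
    (hσ : EigenvaluesGE l σ) :
    relEnt ρ σ ≤ ρ.trace.re * Real.log ρ.trace.re - ρ.trace.re * Real.log l := by
  obtain ⟨V, q, dσ, hq⟩ := hσ
  have dρ := exists_diagonalizes hρ.1
  have hp := dρ.nonneg hρ
  rw [relEnt_eq_sum dρ dσ]
  set p := hρ.1.eigenvalues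
  set t := ρ.trace.re with ht
  calc _ ≤ ∑ i, ∑ j, overlap (hρ.1.eigenvectorUnitary : Matrix ι ι ℂ) V i j *
        (p i * (Real.log t - Real.log l)) := by
        refine Finset.sum_le_sum fun i _ => Finset.sum_le_sum fun j _ =>
          mul_le_mul_of_nonneg_left ?_ (overlap_nonneg _ _ _ _)
        rcases (hp i).eq_or_lt with h | h
        · simp [p, ← h]
        · refine mul_le_mul_of_nonneg_left (sub_le_sub (Real.log_le_log h ?_)
            (Real.log_le_log hl (hq j))) h.le
          rw [ht, dρ.re_trace_eq]
          exact Finset.single_le_sum (fun i _ => hp i) (Finset.mem_univ i)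
    _ = t * (Real.log t - Real.log l) := by
        simp only [← Finset.sum_mul, sum_overlap_left dρ.conjTranspose_mul dσ.mul_conjTranspose,
          one_mul]
        rw [ht, dρ.re_trace_eq]
    _ = _ := by ring

theorem KerLE.smul_left (hk : KerLE σ ρ) {c : ℝ} (hc : 0 < c) : KerLE ((c : ℂ) • σ) ρ := by
  intro w hw
  rw [smul_mulVec] at hw
  exact hk w ((smul_eq_zero.1 hw).resolve_left (by exact_mod_cast hc.ne'))

theorem relEnt_smul_right (hρ : ρ.PosSemidef) (hσ : σ.PosSemidef) (hk : KerLE σ ρ) {c : ℝ}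
    (hc : 0 < c) :
    relEnt ρ ((c : ℂ) • σ) = relEnt ρ σ - ρ.trace.re * Real.log c := by
  have dρ := exists_diagonalizes hρ.1
  have dσ := exists_diagonalizes hσ.1
  rw [relEnt_eq_sum dρ dσ, relEnt_eq_sum dρ (dσ.smul c), dρ.re_trace_eq, Finset.sum_mul,
    ← Finset.sum_sub_distrib]
  refine Finset.sum_congr rfl fun i _ => ?_
  rw [← one_mul (hρ.1.eigenvalues i * Real.log c),
    ← sum_overlap_left dρ.conjTranspose_mul dσ.mul_conjTranspose i, Finset.sum_mul,
    ← Finset.sum_sub_distrib]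
  refine Finset.sum_congr rfl fun j _ => ?_
  by_cases h : overlap (hρ.1.eigenvectorUnitary : Matrix ι ι ℂ)
      (hσ.1.eigenvectorUnitary : Matrix ι ι ℂ) i j * hρ.1.eigenvalues i = 0
  · simp only [← mul_assoc, h, zero_mul, sub_zero]
  · rw [Real.log_mul hc.ne' (hk.eigenvalue_ne_zero dρ dσ h)]
    ring

theorem relEnt_self (ρ : Matrix ι ι ℂ) : relEnt ρ ρ = 0 := sub_self _

theorem KerLE.refl (ρ : Matrix ι ι ℂ) : KerLE ρ ρ := fun _ h => h

/-- The terms with log σ cancel, so the claim is D(ρ₁‖ρ₁+ρ₂) + D(ρ₂‖ρ₁+ρ₂) ≤ 0. Enlarging the second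
argument of D(ρ_i‖ρ_i) = 0 shows that each summand is nonpositive. -/
theorem relEnt_add_relEnt_le {ρ₁ ρ₂ : Matrix ι ι ℂ} (hρ₁ : ρ₁.PosSemidef)
    (hρ₂ : ρ₂.PosSemidef) (σ : Matrix ι ι ℂ) :
    relEnt ρ₁ σ + relEnt ρ₂ σ ≤ relEnt (ρ₁ + ρ₂) σ := by
  have h1 := relEnt_add_right_le hρ₁ hρ₁ hρ₂ (KerLE.refl ρ₁)
  have h2 := relEnt_add_right_le hρ₂ hρ₂ hρ₁ (KerLE.refl ρ₂)
  rw [add_comm ρ₂ ρ₁] at h2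
  rw [relEnt_self] at h1 h2
  simp only [relEnt, Matrix.add_mul, trace_add, Complex.add_re] at *
  linarith

theorem relEntropy_eq_of_kerLE (hρ : ρ.IsHermitian) (hσ : σ.IsHermitian) (hk : KerLE σ ρ) :
    relEntropy ρ σ = ((relEnt ρ σ / Real.log 2 : ℝ) : EReal) := by
  have dρ := exists_diagonalizes hρ
  have dσ := exists_diagonalizes hσ
  unfold relEntropy
  rw [if_pos (show ∀ w : ι → ℂ, _ from hk), relEnt, trace_mul_cfc dρ dσ, trace_mul_cfc_self dρ,
    trace_mul_cfc dρ dσ, trace_mul_cfc_self dρ, sub_div, Finset.sum_div, Finset.sum_div]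
  simp only [Finset.sum_div, mul_div_assoc, Real.logb]

theorem relEntropy_eq_top (hk : ¬ KerLE σ ρ) : relEntropy ρ σ = ⊤ := if_neg hk

/-! ### Tensor products -/

theorem overlap_kronecker (U V : Matrix ι ι ℂ) (U' V' : Matrix κ κ ℂ) (x y : ι × κ) :
    overlap (U ⊗ₖ U') (V ⊗ₖ V') x y = overlap U V x.1 y.1 * overlap U' V' x.2 y.2 := by
  rw [overlap, conjTranspose_kronecker, ← mul_kronecker_mul, kroneckerMap_apply, map_mul]
  rfl

theorem isDensity_kronecker {τ : Matrix κ κ ℂ} (hσ : IsDensity σ) (hτ : IsDensity τ) :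
    IsDensity (σ ⊗ₖ τ) :=
  ⟨hσ.1.kronecker hτ.1, by rw [trace_kronecker, hσ.2, hτ.2, one_mul]⟩

theorem KerLE.kronecker {ρ' σ' : Matrix κ κ ℂ} (hρ : ρ.IsHermitian)
    (hσ : σ.IsHermitian) (hρ' : ρ'.IsHermitian) (hσ' : σ'.IsHermitian) (hk : KerLE σ ρ)
    (hk' : KerLE σ' ρ') : KerLE (σ ⊗ₖ σ') (ρ ⊗ₖ ρ') := by
  have dρ := exists_diagonalizes hρ
  have dσ := exists_diagonalizes hσ
  have dρ' := exists_diagonalizes hρ'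
  have dσ' := exists_diagonalizes hσ'
  refine KerLE.of_overlap (dρ.kronecker dρ') (dσ.kronecker dσ') fun x y h => ?_
  rw [overlap_kronecker, mul_mul_mul_comm]
  by_contra h'
  rcases mul_eq_zero.1 h with h1 | h1
  · exact hk.eigenvalue_ne_zero dρ dσ (left_ne_zero_of_mul h') h1
  · exact hk'.eigenvalue_ne_zero dρ' dσ' (right_ne_zero_of_mul h') h1

/-- Overlaps and eigenvalues factorize in product bases, so this is the classical additivity, with
each factor's weights of total mass one. Logarithms are split only in terms of nonzero weight. -/
theorem relEnt_kronecker {ρ' σ' : Matrix κ κ ℂ} (hρ : IsDensity ρ) (hσ : σ.IsHermitian)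
    (hρ' : IsDensity ρ') (hσ' : σ'.IsHermitian) (hk : KerLE σ ρ) (hk' : KerLE σ' ρ') :
    relEnt (ρ ⊗ₖ ρ') (σ ⊗ₖ σ') = relEnt ρ σ + relEnt ρ' σ' := by
  have dρ := exists_diagonalizes hρ.1.1
  have dσ := exists_diagonalizes hσ
  have dρ' := exists_diagonalizes hρ'.1.1
  have dσ' := exists_diagonalizes hσ'
  have e1 := relEnt_eq_sum dρ dσ
  have e2 := relEnt_eq_sum dρ' dσ'
  have s1 : ∑ i, ∑ j, overlap (hρ.1.1.eigenvectorUnitary : Matrix ι ι ℂ)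
      (hσ.eigenvectorUnitary : Matrix ι ι ℂ) i j * hρ.1.1.eigenvalues i = 1 := by
    simp only [← Finset.sum_mul, sum_overlap_left dρ.conjTranspose_mul dσ.mul_conjTranspose,
      one_mul]
    rw [← dρ.re_trace_eq, hρ.2, Complex.one_re]
  have s2 : ∑ i, ∑ j, overlap (hρ'.1.1.eigenvectorUnitary : Matrix κ κ ℂ)
      (hσ'.eigenvectorUnitary : Matrix κ κ ℂ) i j * hρ'.1.1.eigenvalues i = 1 := by
    simp only [← Finset.sum_mul, sum_overlap_left dρ'.conjTranspose_mul dσ'.mul_conjTranspose,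
      one_mul]
    rw [← dρ'.re_trace_eq, hρ'.2, Complex.one_re]
  have h3 := fun i j => hk.eigenvalue_ne_zero dρ dσ (i := i) (j := j)
  have h3' := fun i j => hk'.eigenvalue_ne_zero dρ' dσ' (i := i) (j := j)
  rw [relEnt_eq_sum (dρ.kronecker dρ') (dσ.kronecker dσ')]
  simp only [overlap_kronecker]
  rw [e1, e2]
  generalize overlap (hρ.1.1.eigenvectorUnitary : Matrix ι ι ℂ)
      (hσ.eigenvectorUnitary : Matrix ι ι ℂ) = a at *
  generalize overlap (hρ'.1.1.eigenvectorUnitary : Matrix κ κ ℂ)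
      (hσ'.eigenvectorUnitary : Matrix κ κ ℂ) = b at *
  generalize hρ.1.1.eigenvalues = p at *
  generalize hρ'.1.1.eigenvalues = p' at *
  generalize hσ.eigenvalues = q at *
  generalize hσ'.eigenvalues = q' at *
  calc _ = ∑ x : ι × κ, ∑ y : ι × κ,
        ((a x.1 y.1 * (p x.1 * (Real.log (p x.1) - Real.log (q y.1)))) * (b x.2 y.2 * p' x.2) +
        (a x.1 y.1 * p x.1) * (b x.2 y.2 * (p' x.2 * (Real.log (p' x.2) - Real.log (q' y.2))))) := by
        refine Finset.sum_congr rfl fun x _ => Finset.sum_congr rfl fun y _ => ?_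
        by_cases h : a x.1 y.1 * p x.1 = 0
        · rw [← mul_assoc (a x.1 y.1) (p x.1), h]
          linear_combination h * b x.2 y.2 * p' x.2 *
            (Real.log (p x.1 * p' x.2) - Real.log (q y.1 * q' y.2))
        by_cases h' : b x.2 y.2 * p' x.2 = 0
        · rw [← mul_assoc (b x.2 y.2) (p' x.2), h']
          linear_combination h' * a x.1 y.1 * p x.1 *
            (Real.log (p x.1 * p' x.2) - Real.log (q y.1 * q' y.2))
        rw [Real.log_mul (right_ne_zero_of_mul h) (right_ne_zero_of_mul h'),
          Real.log_mul (h3 _ _ h) (h3' _ _ h')]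
        ring
    _ = (∑ i, ∑ j, a i j * (p i * (Real.log (p i) - Real.log (q j)))) *
          (∑ i, ∑ j, b i j * p' i) + (∑ i, ∑ j, a i j * p i) *
          ∑ i, ∑ j, b i j * (p' i * (Real.log (p' i) - Real.log (q' j))) := by
        simp only [Finset.sum_add_distrib, Fintype.sum_prod_type, Finset.sum_mul_sum]
    _ = _ := by rw [s1, s2, mul_one, one_mul]

/-! ### Trace norm and continuity -/

theorem Diagonalizes.traceNorm_eq {H : Matrix ι ι ℂ} (h : Diagonalizes U p H) :
    traceNorm H = ∑ i, |p i| := by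
  have h1 : Diagonalizes U (fun i => p i ^ 2) (Hᴴ * H) := by
    refine ⟨h.conjTranspose_mul, h.mul_conjTranspose, ?_⟩
    rw [h.isHermitian, h.eq]
    calc U * diagonal (fun i => (p i : ℂ)) * Uᴴ * (U * diagonal (fun i => (p i : ℂ)) * Uᴴ)
        = U * diagonal (fun i => (p i : ℂ)) * (Uᴴ * U) * diagonal (fun i => (p i : ℂ)) * Uᴴ := by
          simp only [Matrix.mul_assoc]
      _ = _ := by
        rw [h.conjTranspose_mul, Matrix.mul_one, Matrix.mul_assoc U, diagonal_mul_diagonal]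
        simp [sq]
  rw [traceNorm, h1.cfc_eq, (h1.of_eigenvalues fun i => Real.sqrt (p i ^ 2)).re_trace_eq]
  simp only [Real.sqrt_sq_eq_abs]

theorem traceNorm_sub_le_two (hρ : IsDensity ρ) (hσ : IsDensity σ) : traceNorm (ρ - σ) ≤ 2 := by
  have d := exists_diagonalizes (hρ.1.1.sub hσ.1.1)
  rw [d.traceNorm_eq]
  set U : Matrix ι ι ℂ := ((hρ.1.1.sub hσ.1.1).eigenvectorUnitary : Matrix ι ι ℂ)
  have htr : ∀ {τ : Matrix ι ι ℂ}, IsDensity τ → ∑ i, ((Uᴴ * τ * U) i i).re = 1 := by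
    intro τ hτ
    have : (Uᴴ * τ * U).trace = 1 := by
      rw [trace_mul_cycle, d.mul_conjTranspose, Matrix.one_mul, hτ.2]
    rw [← Complex.one_re, ← this, trace, Complex.re_sum]
    rfl
  have hpos : ∀ {τ : Matrix ι ι ℂ}, IsDensity τ → ∀ i, 0 ≤ ((Uᴴ * τ * U) i i).re := fun hτ i =>
    (Complex.nonneg_iff.1 (hτ.1.conjTranspose_mul_mul_same U).diag_nonneg).1
  calc _ ≤ ∑ i, (((Uᴴ * ρ * U) i i).re + ((Uᴴ * σ * U) i i).re) := by
        refine Finset.sum_le_sum fun i _ => ?_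
        have h1 := congrArg Complex.re (d.apply_eq i)
        rw [Matrix.mul_sub, Matrix.sub_mul, Matrix.sub_apply, Complex.ofReal_re, Complex.sub_re] at h1
        rw [h1, abs_le]
        constructor <;> linarith [hpos hρ i, hpos hσ i]
    _ = 2 := by rw [Finset.sum_add_distrib, htr hρ, htr hσ]; norm_num

/-- P and M are the positive and negative parts of ρ - σ; they have equal trace because ρ - σ is
traceless. -/
theorem exists_posSemidef_sub_eq (hρ : IsDensity ρ) (hσ : IsDensity σ) :
    ∃ P M : Matrix ι ι ℂ, P.PosSemidef ∧ M.PosSemidef ∧ σ + P = ρ + M ∧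
      P.trace.re = traceNorm (ρ - σ) / 2 ∧ M.trace.re = traceNorm (ρ - σ) / 2 := by
  have d := exists_diagonalizes (hρ.1.1.sub hσ.1.1)
  set h := (hρ.1.1.sub hσ.1.1).eigenvalues
  have dP := d.of_eigenvalues fun i => max (h i) 0
  have dM := d.of_eigenvalues fun i => max (-h i) 0
  have h0 : ∑ i, h i = 0 := by
    rw [← d.re_trace_eq, trace_sub, hρ.2, hσ.2, sub_self, Complex.zero_re]
  have hP : ∀ i, max (h i) 0 = (|h i| + h i) / 2 := by
    intro i
    rcases le_total (h i) 0 with hi | hi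
    · rw [max_eq_right hi, abs_of_nonpos hi]; ring
    · rw [max_eq_left hi, abs_of_nonneg hi]; ring
  have hM : ∀ i, max (-h i) 0 = (|h i| - h i) / 2 := by
    intro i
    rcases le_total (h i) 0 with hi | hi
    · rw [max_eq_left (by linarith), abs_of_nonpos hi]; ring
    · rw [max_eq_right (by linarith), abs_of_nonneg hi]; ring
  refine ⟨_, _, dP.posSemidef fun i => le_max_right _ _, dM.posSemidef fun i => le_max_right _ _,
    ?_, ?_, ?_⟩
  · rw [add_comm σ, ← sub_eq_sub_iff_add_eq_add]
    conv_rhs => rw [d.eq]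
    rw [← Matrix.sub_mul, ← Matrix.mul_sub, diagonal_sub]
    congr 3
    ext i
    rw [hP, hM]
    push_cast
    ring
  · rw [dP.re_trace_eq, d.traceNorm_eq]
    simp only [hP, ← Finset.sum_div, Finset.sum_add_distrib, h0, add_zero]
  · rw [dM.re_trace_eq, d.traceNorm_eq]
    simp only [hM, ← Finset.sum_div, Finset.sum_sub_distrib, h0, sub_zero]

/-- Continuity of the relative entropy distance: mixing the second argument with `τ`. -/
theorem relEnt_half_add_half_le {ψ τ : Matrix ι ι ℂ} (hρ : IsDensity ρ) (hψ : IsDensity ψ)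
    (hσ : IsDensity σ) (hτ : IsDensity τ) (hk : KerLE σ ρ) {l : ℝ} (hl : 0 < l)
    (hτl : EigenvaluesGE l τ) :
    KerLE (((1 / 2 : ℝ) : ℂ) • σ + ((1 / 2 : ℝ) : ℂ) • τ) ψ ∧
    relEnt ψ (((1 / 2 : ℝ) : ℂ) • σ + ((1 / 2 : ℝ) : ℂ) • τ) ≤
      relEnt ρ σ + (1 + traceNorm (ρ - ψ) / 2) * Real.log 2 -
        traceNorm (ρ - ψ) / 2 * Real.log l := by
  obtain ⟨P, M, hP, hM, hPM, tP, tM⟩ := exists_posSemidef_sub_eq hρ hψ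
  set ε := traceNorm (ρ - ψ) / 2
  have hhalf : (0 : ℝ) < 1 / 2 := by norm_num
  have hc : (0 : ℂ) ≤ ((1 / 2 : ℝ) : ℂ) := Complex.zero_le_real.2 hhalf.le
  have hσ' := hσ.1.smul hc
  have hτ' := hτ.1.smul hc
  set ω := ((1 / 2 : ℝ) : ℂ) • σ + ((1 / 2 : ℝ) : ℂ) • τ with hω
  have hkω : ∀ {X : Matrix ι ι ℂ}, X.PosSemidef → KerLE ω X := by
    intro X hX
    have := KerLE.add PosSemidef.zero hX hσ' hτ' (KerLE.zero _)
      ((hτl.kerLE hl hX.1).smul_left hhalf)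
    rwa [zero_add] at this
  have hωd : IsDensity ω := by
    refine ⟨hσ'.add hτ', ?_⟩
    rw [hω, trace_add, trace_smul, trace_smul, hσ.2, hτ.2]
    push_cast
    norm_num
  refine ⟨hkω hψ.1, ?_⟩
  -- D(ψ‖ω) + D(P‖ω) ≤ D(ψ+P‖ω) = D(ρ+M‖ω) ≤ D(ρ‖σ/2) + D(M‖τ/2). The lower bound ε log ε on D(P‖ω)
  -- cancels the ε log ε in the upper bound on D(M‖τ).
  have h1 := relEnt_add_relEnt_le hψ.1 hP ω
  have h2 := trace_mul_log_trace_le_relEnt hP hωd (hkω hP)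
  have h3 := relEnt_add_le hρ.1 hM hσ' hτ' (hk.smul_left hhalf)
    ((hτl.kerLE hl hM.1).smul_left hhalf)
  have h4 := relEnt_le_of_eigenvaluesGE hM hl hτl
  rw [relEnt_smul_right hρ.1 hσ.1 hk hhalf,
    relEnt_smul_right hM hτ.1 (hτl.kerLE hl hM.1) hhalf, tM, hρ.2, Complex.one_re] at h3
  rw [hPM] at h1
  rw [tP] at h2
  rw [tM] at h4
  have h5 : Real.log (1 / 2) = - Real.log 2 := by rw [one_div, Real.log_inv]
  rw [h5] at h3
  linarith

end Estimates

end QuantumResource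

namespace QuantumResource

open Matrix

/-! ### Operators on tensor products of systems -/

namespace Systems

variable {Q : Systems.{u, v}}

theorem tensorHom_tensorOp {A₁ B₁ A₂ B₂ : Q.Sys} (M : Q.Op A₁ →ₗ[ℂ] Q.Op B₁)
    (N : Q.Op A₂ →ₗ[ℂ] Q.Op B₂) (X : Q.Op A₁) (Y : Q.Op A₂) :
    tensorHom M N (tensorOp X Y) = tensorOp (M X) (N Y) := by
  rw [tensorHom, tensorOp, LinearMap.comp_apply, LinearMap.comp_apply, relabel_relabel_symm,
    tensorMap_kronecker]
  rfl

theorem relabel_assocIdx_symm {A B C : Q.Sys} (X : Q.Op A) (Y : Q.Op B) (Z : Q.Op C) :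
    relabel (assocIdx A B C).symm (tensorOp X (tensorOp Y Z)) = tensorOp (tensorOp X Y) Z := by
  ext i j
  simp [relabel, tensorOp, assocIdx, kroneckerMap_apply, mul_assoc]

theorem relabel_leftUnitIdx_symm {A : Q.Sys} (X : Q.Op A) :
    relabel (leftUnitIdx A).symm X = tensorOp (1 : Q.Op Q.one) X := by
  ext i j
  simp [relabel, tensorOp, leftUnitIdx, kroneckerMap_apply, one_apply, Subsingleton.elim _ default]

theorem relabel_rightUnitIdx {A : Q.Sys} (X : Q.Op A) :
    relabel (rightUnitIdx A) (tensorOp X (1 : Q.Op Q.one)) = X := by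
  ext i j
  simp [relabel, tensorOp, rightUnitIdx, kroneckerMap_apply]

theorem isDensity_tensorOp {A B : Q.Sys} {X : Q.Op A} {Y : Q.Op B} (hX : IsDensity X)
    (hY : IsDensity Y) : IsDensity (tensorOp X Y) := by
  have := isDensity_kronecker hX hY
  exact ⟨posSemidef_relabel this.1, (trace_relabel _ _).trans this.2⟩

theorem isDensity_one : IsDensity (1 : Q.Op Q.one) :=
  ⟨PosSemidef.one, by simp [trace]⟩

theorem isDensity_opPow {A : Q.Sys} {X : Q.Op A} (hX : IsDensity X) :
    ∀ n, IsDensity (opPow X n)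
  | 0 => isDensity_one
  | n + 1 => isDensity_tensorOp (isDensity_opPow hX n) hX

theorem eigenvaluesGE_opPow {A : Q.Sys} {X : Q.Op A} {l : ℝ} (hl : 0 ≤ l)
    (hX : EigenvaluesGE l X) : ∀ n, EigenvaluesGE (l ^ n) (opPow X n)
  | 0 => ⟨1, fun _ => 1, ⟨by simp, by simp, by simp [opPow]; rfl⟩, by simp⟩
  | n + 1 => by
    rw [pow_succ]
    exact ((eigenvaluesGE_opPow hl hX n).kronecker hX (pow_nonneg hl n) hl).relabel _

theorem traceHom_eq_one {A : Q.Sys} {X : Q.Op A} (hX : IsDensity X) :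
    traceHom A X = (1 : Q.Op Q.one) := by
  simp [traceHom, hX.2]

/-- The map `N^{⊗ n}`. -/
def homPow {A B : Q.Sys} (N : Q.Op A →ₗ[ℂ] Q.Op B) :
    (n : ℕ) → Q.Op (pow A n) →ₗ[ℂ] Q.Op (pow B n)
  | 0 => LinearMap.id
  | n + 1 => tensorHom (homPow N n) N

theorem homPow_opPow {A B : Q.Sys} (N : Q.Op A →ₗ[ℂ] Q.Op B) (X : Q.Op A) :
    ∀ n, homPow N n (opPow X n) = opPow (N X) n
  | 0 => rfl
  | n + 1 => by
    rw [opPow, opPow, ← homPow_opPow N X n]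
    exact tensorHom_tensorOp _ _ _ _

/-- The canonical identification of `A^{⊗ m} ⊗ A^{⊗ n}` with `A^{⊗ (m + n)}`. -/
def powAdd (A : Q.Sys) (m : ℕ) :
    (n : ℕ) → Q.Op (Q.tensor (pow A m) (pow A n)) →ₗ[ℂ] Q.Op (pow A (m + n))
  | 0 => relabel (rightUnitIdx (pow A m))
  | n + 1 => tensorHom (powAdd A m n) LinearMap.id ∘ₗ
      relabel (assocIdx (pow A m) (pow A n) A).symm

theorem powAdd_tensorOp {A : Q.Sys} (X : Q.Op A) (m : ℕ) :
    ∀ n, powAdd A m n (tensorOp (opPow X m) (opPow X n)) = opPow X (m + n)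
  | 0 => relabel_rightUnitIdx _
  | n + 1 => by
    change tensorHom (powAdd A m n) LinearMap.id (relabel (assocIdx (pow A m) (pow A n) A).symm
      (tensorOp (opPow X m) (tensorOp (opPow X n) X))) = tensorOp (opPow X (m + n)) X
    rw [relabel_assocIdx_symm, tensorHom_tensorOp, powAdd_tensorOp X m n, LinearMap.id_apply]

end Systems

/-! ### The relative entropy of resource -/

namespace QRT

open Systems

variable {Q : QRT.{u, v}}

/-! ### Closure properties of free operations and free states -/

theorem isDensity_map {A B : Q.Sys} {N : Q.Op A →ₗ[ℂ] Q.Op B} (hN : N ∈ Q.O A B) {ρ : Q.Op A}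
    (hρ : IsDensity ρ) : IsDensity (N ρ) :=
  ⟨(Q.O_cptp A B N hN).1.posSemidef hρ.1, by rw [(Q.O_cptp A B N hN).2, hρ.2]⟩

theorem isDensity_of_mem_freeStates {A : Q.Sys} {σ : Q.Op A} (hσ : σ ∈ Q.freeStates A) :
    IsDensity σ :=
  Q.S_density A σ hσ.1

theorem homPow_mem {A B : Q.Sys} {N : Q.Op A →ₗ[ℂ] Q.Op B} (hN : N ∈ Q.O A B) :
    ∀ n, homPow N n ∈ Q.O (pow A n) (pow B n)
  | 0 => Q.id_mem _
  | n + 1 => Q.tensor_mem _ _ _ _ _ (homPow_mem hN n) _ hN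

theorem powAdd_mem (A : Q.Sys) (m : ℕ) :
    ∀ n, powAdd A m n ∈ Q.O (Q.tensor (pow A m) (pow A n)) (pow A (m + n))
  | 0 => Q.right_unit_mem _
  | n + 1 => Q.comp_mem _ _ _ _ (Q.assoc_symm_mem _ _ _) _
      (Q.tensor_mem _ _ _ _ _ (powAdd_mem A m n) _ (Q.id_mem A))

theorem map_mem_freeStates {A B : Q.Sys} {N : Q.Op A →ₗ[ℂ] Q.Op B} (hN : N ∈ Q.O A B)
    {σ : Q.Op A} (hσ : σ ∈ Q.freeStates A) : N σ ∈ Q.freeStates B := by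
  refine ⟨Q.O_mapsTo A B N hN σ hσ.1, fun C φ hφ => ?_⟩
  obtain ⟨M, hM, rfl⟩ := hσ.2 C φ hφ
  exact ⟨N ∘ₗ M, Q.comp_mem C A B M hM N hN, rfl⟩

/-- Discard the given state by the trace, split 1 as 1 ⊗ 1, and apply M ⊗ N, where M and N prepare σ
and τ from 1. Here 1 is a state of interest, being the trace of σ. -/
theorem tensorOp_mem_freeStates {A B : Q.Sys} {σ : Q.Op A} {τ : Q.Op B}
    (hσ : σ ∈ Q.freeStates A) (hτ : τ ∈ Q.freeStates B) :
    tensorOp σ τ ∈ Q.freeStates (Q.tensor A B) := by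
  have h1 : (1 : Q.Op Q.one) ∈ Q.S Q.one := by
    rw [← traceHom_eq_one (isDensity_of_mem_freeStates hσ)]
    exact Q.O_mapsTo _ _ _ (Q.trace_mem A) _ hσ.1
  obtain ⟨M, hM, hMσ⟩ := hσ.2 _ _ h1
  obtain ⟨N, hN, hNτ⟩ := hτ.2 _ _ h1
  have key : ∀ (C : Q.Sys), ∀ φ ∈ Q.S C, ∃ K ∈ Q.O C (Q.tensor A B), tensorOp σ τ = K φ := by
    intro C φ hφ
    refine ⟨tensorHom M N ∘ₗ relabel (leftUnitIdx Q.one).symm ∘ₗ traceHom C,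
      Q.comp_mem _ _ _ _ (Q.comp_mem _ _ _ _ (Q.trace_mem C) _ (Q.left_unit_symm_mem _)) _
        (Q.tensor_mem _ _ _ _ _ hM _ hN), ?_⟩
    rw [LinearMap.comp_apply, LinearMap.comp_apply, traceHom_eq_one (Q.S_density C φ hφ),
      relabel_leftUnitIdx_symm, tensorHom_tensorOp, ← hMσ, ← hNτ]
  refine ⟨?_, key⟩
  obtain ⟨K, hK, h⟩ := key _ _ h1
  rw [h]
  exact Q.O_mapsTo _ _ _ hK _ h1

theorem opPow_mem_freeStates {A : Q.Sys} {σ : Q.Op A} (hσ : σ ∈ Q.freeStates A) :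
    ∀ n, opPow σ n ∈ Q.freeStates (pow A n)
  | 0 => by
    have := map_mem_freeStates (Q.trace_mem A) hσ
    rwa [traceHom_eq_one (isDensity_of_mem_freeStates hσ)] at this
  | n + 1 => tensorOp_mem_freeStates (opPow_mem_freeStates hσ n) hσ

theorem IsConvex.half_add_half_mem (hc : Q.IsConvex) {A : Q.Sys} {σ τ : Q.Op A}
    (hσ : σ ∈ Q.freeStates A) (hτ : τ ∈ Q.freeStates A) :
    ((1 / 2 : ℝ) : ℂ) • σ + ((1 / 2 : ℝ) : ℂ) • τ ∈ Q.freeStates A := by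
  have key : ∀ (C : Q.Sys), ∀ φ ∈ Q.S C, ∃ K ∈ Q.O C A,
      ((1 / 2 : ℝ) : ℂ) • σ + ((1 / 2 : ℝ) : ℂ) • τ = K φ := by
    intro C φ hφ
    obtain ⟨M, hM, rfl⟩ := hσ.2 C φ hφ
    obtain ⟨N, hN, rfl⟩ := hτ.2 C φ hφ
    refine ⟨_, hc C A hM hN (a := 1 / 2) (b := 1 / 2) (by norm_num) (by norm_num) (by norm_num),
      ?_⟩
    rw [LinearMap.add_apply, LinearMap.smul_apply, LinearMap.smul_apply, Complex.coe_smul,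
      Complex.coe_smul]
  refine ⟨?_, key⟩
  obtain ⟨K, hK, h⟩ := key A σ hσ.1
  rw [h]
  exact Q.O_mapsTo _ _ _ hK _ hσ.1

/-! ### The relative entropy of resource as a real infimum -/

/-- The finite values `D(ρ‖σ)` for free states `σ`. -/
def relEntValues {A : Q.Sys} (ρ : Q.Op A) : Set ℝ :=
  {d | ∃ σ ∈ Q.freeStates A, KerLE σ ρ ∧ d = relEnt ρ σ / Real.log 2}

/-- The relative entropy of resource as a real number. -/
def realRelEnt {A : Q.Sys} (ρ : Q.Op A) : ℝ :=
  sInf (relEntValues ρ)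

theorem relEntValues_nonneg {A : Q.Sys} {ρ : Q.Op A} (hρ : IsDensity ρ) :
    ∀ d ∈ relEntValues ρ, 0 ≤ d := by
  rintro d ⟨σ, hσ, hk, rfl⟩
  exact div_nonneg (relEnt_nonneg hρ (isDensity_of_mem_freeStates hσ) hk)
    (Real.log_nonneg one_le_two)

theorem bddBelow_relEntValues {A : Q.Sys} {ρ : Q.Op A} (hρ : IsDensity ρ) :
    BddBelow (relEntValues ρ) :=
  ⟨0, relEntValues_nonneg hρ⟩

theorem HasFullRankFreeStates.exists_eigenvaluesGE (hf : Q.HasFullRankFreeStates) (A : Q.Sys) :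
    ∃ σ ∈ Q.freeStates A, ∃ l : ℝ, 0 < l ∧ l ≤ 1 ∧ EigenvaluesGE l σ := by
  obtain ⟨σ, hσ, hr⟩ := hf A
  exact ⟨σ, hσ, QuantumResource.exists_eigenvaluesGE (isDensity_of_mem_freeStates hσ).1 hr⟩

theorem HasFullRankFreeStates.relEntValues_nonempty (hf : Q.HasFullRankFreeStates) {A : Q.Sys}
    {ρ : Q.Op A} (hρ : IsDensity ρ) : (relEntValues ρ).Nonempty := by
  obtain ⟨σ, hσ, l, hl, -, hσl⟩ := hf.exists_eigenvaluesGE A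
  exact ⟨_, σ, hσ, hσl.kerLE hl hρ.1.1, rfl⟩

theorem realRelEnt_nonneg {A : Q.Sys} {ρ : Q.Op A} (hρ : IsDensity ρ) : 0 ≤ realRelEnt ρ :=
  Real.sInf_nonneg (relEntValues_nonneg hρ)

/-- Free states violating the kernel condition contribute ⊤, which does not affect the infimum since
a full-rank free state gives a finite value. -/
theorem HasFullRankFreeStates.relEntropyOfResource_eq (hf : Q.HasFullRankFreeStates) {A : Q.Sys}
    {ρ : Q.Op A} (hρ : IsDensity ρ) :
    Q.relEntropyOfResource ρ = (realRelEnt ρ : EReal) := by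
  have hle : ∀ d ∈ relEntValues ρ, Q.relEntropyOfResource ρ ≤ (d : EReal) := by
    rintro d ⟨σ, hσ, hk, rfl⟩
    rw [← relEntropy_eq_of_kerLE hρ.1.1 (isDensity_of_mem_freeStates hσ).1.1 hk]
    exact iInf₂_le σ hσ
  have hge : (realRelEnt ρ : EReal) ≤ Q.relEntropyOfResource ρ := by
    refine le_iInf₂ fun σ hσ => ?_
    by_cases hk : KerLE σ ρ
    · rw [relEntropy_eq_of_kerLE hρ.1.1 (isDensity_of_mem_freeStates hσ).1.1 hk,
        EReal.coe_le_coe_iff]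
      exact csInf_le (bddBelow_relEntValues hρ) ⟨σ, hσ, hk, rfl⟩
    · rw [relEntropy_eq_top hk]
      exact le_top
  refine le_antisymm ?_ hge
  obtain ⟨d, hd⟩ := hf.relEntValues_nonempty hρ
  have htop : Q.relEntropyOfResource ρ ≠ ⊤ := ne_top_of_le_ne_top (EReal.coe_ne_top d) (hle d hd)
  have hbot : Q.relEntropyOfResource ρ ≠ ⊥ := ne_bot_of_le_ne_bot (EReal.coe_ne_bot _) hge
  lift Q.relEntropyOfResource ρ to ℝ using ⟨htop, hbot⟩ with m
  exact EReal.coe_le_coe_iff.2 (le_csInf ⟨d, hd⟩ fun d hd => EReal.coe_le_coe_iff.1 (hle d hd))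

/-- Reduces a comparison of infima to one free state at a time; c is measured in bits, whence the
factor log 2. -/
theorem HasFullRankFreeStates.realRelEnt_le_add (hf : Q.HasFullRankFreeStates) {A B : Q.Sys}
    {ρ : Q.Op A} {ρ' : Q.Op B} (hρ : IsDensity ρ) (hρ' : IsDensity ρ') {c : ℝ}
    (h : ∀ σ ∈ Q.freeStates A, KerLE σ ρ → ∃ σ' ∈ Q.freeStates B, KerLE σ' ρ' ∧
      relEnt ρ' σ' ≤ relEnt ρ σ + c * Real.log 2) :
    realRelEnt ρ' ≤ realRelEnt ρ + c := by
  rw [← sub_le_iff_le_add]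
  refine le_csInf (hf.relEntValues_nonempty hρ) ?_
  rintro d ⟨σ, hσ, hk, rfl⟩
  obtain ⟨σ', hσ', hk', hle⟩ := h σ hσ hk
  rw [sub_le_iff_le_add]
  refine (csInf_le (bddBelow_relEntValues hρ') ⟨σ', hσ', hk', rfl⟩).trans ?_
  have hlog := Real.log_pos one_lt_two
  rw [div_le_iff₀ hlog, add_mul, div_mul_cancel₀ _ hlog.ne']
  exact hle

theorem HasFullRankFreeStates.realRelEnt_map_le (hf : Q.HasFullRankFreeStates) {A B : Q.Sys}
    {N : Q.Op A →ₗ[ℂ] Q.Op B} (hN : N ∈ Q.O A B) {ρ : Q.Op A} (hρ : IsDensity ρ) :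
    realRelEnt (N ρ) ≤ realRelEnt ρ := by
  have := hf.realRelEnt_le_add (c := 0) hρ (isDensity_map hN hρ) fun σ hσ hk =>
    ⟨N σ, map_mem_freeStates hN hσ, by
      have := (Q.O_cptp A B N hN).relEnt_le hρ.1 (isDensity_of_mem_freeStates hσ).1 hk
      rwa [zero_mul, add_zero]⟩
  rwa [add_zero] at this

theorem HasFullRankFreeStates.realRelEnt_tensorOp_le (hf : Q.HasFullRankFreeStates) {A B : Q.Sys}
    {ρ : Q.Op A} {ρ' : Q.Op B} (hρ : IsDensity ρ) (hρ' : IsDensity ρ') :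
    realRelEnt (Q := Q) (tensorOp ρ ρ') ≤ realRelEnt ρ + realRelEnt ρ' := by
  rw [← sub_le_iff_le_add]
  refine le_csInf (hf.relEntValues_nonempty hρ) ?_
  rintro d ⟨σ, hσ, hk, rfl⟩
  rw [sub_le_iff_le_add, add_comm]
  refine hf.realRelEnt_le_add hρ' (isDensity_tensorOp hρ hρ') fun σ' hσ' hk' => ?_
  have dσ := isDensity_of_mem_freeStates hσ
  have dσ' := isDensity_of_mem_freeStates hσ'
  have h := (KerLE.kronecker hρ.1.1 dσ.1.1 hρ'.1.1 dσ'.1.1 hk hk').relabel_relEnt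
    (Q.tensorIdx A B).symm (hρ.1.kronecker hρ'.1) (dσ.1.kronecker dσ'.1)
  refine ⟨_, tensorOp_mem_freeStates hσ hσ', h.1, h.2.trans ?_⟩
  rw [relEnt_kronecker hρ dσ.1.1 hρ' dσ'.1.1 hk hk', add_comm,
    div_mul_cancel₀ _ (Real.log_pos one_lt_two).ne']

/-! ### Subadditivity, asymptotic continuity and regularization -/

theorem HasFullRankFreeStates.subadditive (hf : Q.HasFullRankFreeStates) {A : Q.Sys} {ρ : Q.Op A}
    (hρ : IsDensity ρ) : Subadditive fun n => realRelEnt (Q := Q) (opPow ρ n) := by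
  intro m n
  have h := hf.realRelEnt_map_le (powAdd_mem A m n)
    (isDensity_tensorOp (isDensity_opPow hρ m) (isDensity_opPow hρ n))
  rw [powAdd_tensorOp] at h
  exact h.trans (hf.realRelEnt_tensorOp_le (isDensity_opPow hρ m) (isDensity_opPow hρ n))

theorem bddBelow_realRelEnt_div {A : Q.Sys} {ρ : Q.Op A} (hρ : IsDensity ρ) :
    BddBelow (Set.range fun n : ℕ => realRelEnt (Q := Q) (opPow ρ n) / n) := by
  refine ⟨0, ?_⟩
  rintro _ ⟨n, rfl⟩
  exact div_nonneg (realRelEnt_nonneg (isDensity_opPow hρ n)) n.cast_nonneg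

/-- Asymptotic continuity of the relative entropy of resource on `A^{⊗ m}`. -/
theorem HasFullRankFreeStates.realRelEnt_le_add_traceNorm (hf : Q.HasFullRankFreeStates)
    (hc : Q.IsConvex) (A : Q.Sys) : ∃ K : ℝ, 0 ≤ K ∧ ∀ (m : ℕ) (ρ ψ : Q.Op (pow A m)),
      IsDensity ρ → IsDensity ψ →
      realRelEnt ψ ≤ realRelEnt ρ + (2 + traceNorm (ρ - ψ) / 2 * (m * K)) := by
  -- One τ serves for all m: the eigenvalues of τ^{⊗ m} are at least l ^ m, whose logarithm is
  -- linear in m.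
  obtain ⟨τ, hτ, l, hl, hl1, hτl⟩ := hf.exists_eigenvaluesGE A
  have hlog := Real.log_pos one_lt_two
  refine ⟨-Real.log l / Real.log 2,
    div_nonneg (neg_nonneg.2 (Real.log_nonpos hl.le hl1)) hlog.le, fun m ρ ψ hρ hψ => ?_⟩
  refine hf.realRelEnt_le_add hρ hψ fun σ hσ hk => ?_
  have hτm := opPow_mem_freeStates hτ m
  have h := relEnt_half_add_half_le hρ hψ (isDensity_of_mem_freeStates hσ)
    (isDensity_of_mem_freeStates hτm) hk (pow_pos hl m) (eigenvaluesGE_opPow hl.le hτl m)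
  refine ⟨_, hc.half_add_half_mem hσ hτm, h.1, h.2.trans ?_⟩
  -- With ε ≤ 1, the term (1 + ε) log 2 is at most 2 log 2.
  have h2 := traceNorm_sub_le_two hρ hψ
  rw [Real.log_pow]
  have h3 : (2 + traceNorm (ρ - ψ) / 2 * (m * (-Real.log l / Real.log 2))) * Real.log 2 =
      2 * Real.log 2 - traceNorm (ρ - ψ) / 2 * (m * Real.log l) := by
    field_simp
    ring
  rw [h3]
  nlinarith

/-- The regularized relative entropy of resource. -/
def regRelEnt (Q : QRT.{u, v}) (hf : Q.HasFullRankFreeStates) (A : Q.Sys) (ψ : Q.S A) : ℝ :=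
  (hf.subadditive (Q.S_density A ψ.1 ψ.2)).lim

theorem tendsto_regRelEnt (hf : Q.HasFullRankFreeStates) {A : Q.Sys} (ψ : Q.S A) :
    Tendsto (fun n : ℕ => realRelEnt (Q := Q) (opPow ψ.1 n) / n) atTop
      (𝓝 (Q.regRelEnt hf A ψ)) :=
  (hf.subadditive (Q.S_density A ψ.1 ψ.2)).tendsto_lim
    (bddBelow_realRelEnt_div (Q.S_density A ψ.1 ψ.2))

theorem regRelEnt_nonneg (hf : Q.HasFullRankFreeStates) {A : Q.Sys} (ψ : Q.S A) :
    0 ≤ Q.regRelEnt hf A ψ :=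
  ge_of_tendsto' (tendsto_regRelEnt hf ψ) fun n =>
    div_nonneg (realRelEnt_nonneg (isDensity_opPow (Q.S_density A ψ.1 ψ.2) n)) n.cast_nonneg

theorem mul_regRelEnt_le (hf : Q.HasFullRankFreeStates) {A : Q.Sys} (ψ : Q.S A) (n : ℕ) :
    n * Q.regRelEnt hf A ψ ≤ realRelEnt (Q := Q) (opPow ψ.1 n) := by
  rcases Nat.eq_zero_or_pos n with rfl | hn
  · rw [Nat.cast_zero, zero_mul]
    exact realRelEnt_nonneg (isDensity_opPow (Q.S_density A ψ.1 ψ.2) 0)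
  · have := (hf.subadditive (Q.S_density A ψ.1 ψ.2)).lim_le_div
      (bddBelow_realRelEnt_div (Q.S_density A ψ.1 ψ.2)) hn.ne'
    rw [le_div_iff₀ (by exact_mod_cast hn), mul_comm] at this
    exact this

theorem isRegularizedRelEntropy_regRelEnt (hf : Q.HasFullRankFreeStates) :
    Q.IsRegularizedRelEntropy (Q.regRelEnt hf) := by
  intro A ψ
  refine (continuous_coe_real_ereal.tendsto _).comp (tendsto_regRelEnt hf ψ) |>.congr fun n => ?_
  rw [hf.relEntropyOfResource_eq (isDensity_opPow (Q.S_density A ψ.1 ψ.2) n), Function.comp_apply,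
    EReal.coe_div]
  rfl

/-! ### Monotonicity and consistency of the regularization -/

theorem isResourceMeasure_regRelEnt (hf : Q.HasFullRankFreeStates) :
    Q.IsResourceMeasure (Q.regRelEnt hf) := by
  intro A B N hN ψ
  refine le_of_tendsto_of_tendsto' (tendsto_regRelEnt hf _) (tendsto_regRelEnt hf ψ) fun n => ?_
  refine div_le_div_of_nonneg_right ?_ n.cast_nonneg
  have := hf.realRelEnt_map_le (homPow_mem hN n) (isDensity_opPow (Q.S_density A ψ.1 ψ.2) n)
  rwa [homPow_opPow] at this

theorem mul_regRelEnt_le_of_mem_achievableRates (hf : Q.HasFullRankFreeStates)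
    (hc : Q.IsConvex) {A B : Q.Sys} (φ : Q.S A) (ψ : Q.S B) {r : ℝ}
    (hr : r ∈ Q.achievableRates φ ψ) :
    r * Q.regRelEnt hf B ψ ≤ Q.regRelEnt hf A φ := by
  obtain ⟨hr0, N, hN, hlim⟩ := hr
  obtain ⟨K, hK, hcont⟩ := hf.realRelEnt_le_add_traceNorm hc B
  have dφ := isDensity_opPow (Q := Q.toSystems) (Q.S_density A φ.1 φ.2)
  have dψ := isDensity_opPow (Q := Q.toSystems) (Q.S_density B ψ.1 ψ.2)
  have dN := fun n => isDensity_map (hN n) (dφ n)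
  have hbdd : IsBoundedUnder (· ≤ ·) atTop
      fun n => traceNorm (N n (opPow φ.1 n) - opPow ψ.1 ⌈r * n⌉₊) :=
    isBoundedUnder_of ⟨2, fun n => traceNorm_sub_le_two (dN n) (dψ _)⟩
  have key : ∀ η : ℝ, 0 < η →
      r * Q.regRelEnt hf B ψ ≤ Q.regRelEnt hf A φ + η * (r * K) := by
    intro η hη
    -- A vanishing liminf gives good n only infinitely often; this suffices because the right-hand
    -- side converges. The threshold 2η matches the halved trace norm in the continuity bound.
    have hfreq : ∃ᶠ n : ℕ in atTop,
        traceNorm (N n (opPow φ.1 n) - opPow ψ.1 ⌈r * n⌉₊) < 2 * η :=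
      frequently_lt_of_liminf_lt hbdd.isCoboundedUnder_ge (by rw [hlim]; positivity)
    have hinv : Tendsto (fun n : ℕ => 1 / (n : ℝ)) atTop (𝓝 0) :=
      tendsto_one_div_atTop_nhds_zero_nat
    have htend : Tendsto (fun n : ℕ => realRelEnt (Q := Q) (opPow φ.1 n) / n +
        1 / (n : ℝ) * (2 + η * K) + η * (r * K)) atTop
        (𝓝 (Q.regRelEnt hf A φ + 0 * (2 + η * K) + η * (r * K))) :=
      ((tendsto_regRelEnt hf φ).add (hinv.mul_const _)).add_const _
    rw [zero_mul, add_zero] at htend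
    refine ge_of_tendsto_of_frequently htend ?_
    refine (hfreq.and_eventually (eventually_gt_atTop 0)).mono ?_
    rintro n ⟨hn, hn0⟩
    have hn' : (0 : ℝ) < n := by exact_mod_cast hn0
    set m := ⌈r * n⌉₊ with hm
    have hm1 : r * n ≤ m := Nat.le_ceil _
    -- Rounding up costs an extra η K, which vanishes after division by n.
    have hm2 : (m : ℝ) < r * n + 1 := Nat.ceil_lt_add_one (mul_nonneg hr0 hn'.le)
    have h1 := hcont m _ _ (dN n) (dψ m)
    have h2 := hf.realRelEnt_map_le (hN n) (dφ n)
    have h3 := mul_regRelEnt_le hf ψ m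
    have h4 := mul_le_mul_of_nonneg_right hm1 (regRelEnt_nonneg hf ψ)
    have h5 : traceNorm (N n (opPow φ.1 n) - opPow ψ.1 m) / 2 * (m * K) ≤
        η * ((r * n + 1) * K) :=
      mul_le_mul (by linarith) (mul_le_mul_of_nonneg_right hm2.le hK) (by positivity) hη.le
    have h6 : r * n * Q.regRelEnt hf B ψ ≤ realRelEnt (Q := Q) (opPow φ.1 n) +
        (2 + η * K) + η * (r * K) * n := by
      linarith
    have h7 : realRelEnt (Q := Q) (opPow φ.1 n) / n + 1 / (n : ℝ) * (2 + η * K) + η * (r * K) =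
        (realRelEnt (Q := Q) (opPow φ.1 n) + (2 + η * K) + η * (r * K) * n) / n := by
      field_simp
    rw [h7, le_div_iff₀ hn']
    linarith
  have hcontη : Tendsto (fun η : ℝ => Q.regRelEnt hf A φ + η * (r * K)) (𝓝[>] 0)
      (𝓝 (Q.regRelEnt hf A φ + 0 * (r * K))) :=
    (tendsto_nhdsWithin_of_tendsto_nhds tendsto_id).mul_const _ |>.const_add _
  rw [zero_mul, add_zero] at hcontη
  exact ge_of_tendsto hcontη (eventually_nhdsWithin_of_forall key)

theorem isConsistentResourceMeasure_regRelEnt (hf : Q.HasFullRankFreeStates)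
    (hc : Q.IsConvex) : Q.IsConsistentResourceMeasure (Q.regRelEnt hf) := by
  refine ⟨isResourceMeasure_regRelEnt hf, fun A B ψ φ => ?_⟩
  -- If the value at ψ is zero, the rate may be infinite and 0 * ∞ = 0 applies; otherwise the rate
  -- is bounded by a finite quotient.
  rcases (regRelEnt_nonneg hf ψ).eq_or_lt with h | h
  · rw [← h, EReal.coe_zero, zero_mul]
    exact_mod_cast regRelEnt_nonneg hf φ
  · have hle : Q.conversionRate φ ψ ≤
        ((Q.regRelEnt hf B φ / Q.regRelEnt hf A ψ : ℝ) : EReal) := by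
      refine iSup₂_le fun r hr => EReal.coe_le_coe_iff.2 ?_
      rw [le_div_iff₀ h]
      exact mul_regRelEnt_le_of_mem_achievableRates hf hc φ ψ hr
    refine (mul_le_mul_of_nonneg_left hle (EReal.coe_nonneg.2 h.le)).trans (le_of_eq ?_)
    rw [← EReal.coe_mul, mul_div_cancel₀ _ h.ne']

end QRT

end QuantumResource

end

theorem mainTheorem11 (Q : QuantumResource.QRT.{u, v}) (hconvex : Q.IsConvex)
    (hfull : Q.HasFullRankFreeStates) :
    ∃ R : (A : Q.Sys) → Q.S A → ℝ,
      Q.IsRegularizedRelEntropy R ∧ Q.IsConsistentResourceMeasure R :=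
  ⟨Q.regRelEnt hfull, QuantumResource.QRT.isRegularizedRelEntropy_regRelEnt hfull,
    QuantumResource.QRT.isConsistentResourceMeasure_regRelEnt hfull hconvex⟩
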